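/- Let $k\in\mathbb N$. A $k$-graph $(\Lambda,d)$ is a countable small category $\Lambda$ (its morphisms are called paths, its objects, identified with the identity morphisms, vertices; $s$ and $r$ are the domain and codomain maps) with a functor $d:\Lambda\to\mathbb N^k$ such that whenever $d(\lambda)=m+n$ there are unique paths $\mu,\nu$ with $\lambda=\mu\nu$, $d(\mu)=m$, $d(\nu)=n$. Put $\Lambda^{\min}(\lambda,\mu)=\{(\alpha,\beta):\lambda\alpha=\mu\beta,\ d(\lambda\alpha)=d(\lambda)\vee d(\mu)\}$, where $\vee$ is the coordinatewise maximum; $\Lambda$ is finitely aligned if all these sets are finite. A set $E$ of paths with range $v$ is exhaustive if for every path $\mu$ with range $v$ there is $\lambda\in E$ with $\Lambda^{\min}(\lambda,\mu)\neq\emptyset$. For a finitely aligned $k$-graph $\Lambda$, a Cuntz–Krieger $\Lambda$-family is a family $\{t_\lambda:\lambda\in\Lambda\}$ of partial isometries in a $C^*$-algebra such that (i) the $t_v$, for $v$ a vertex, are mutually orthogonal projections; (ii) $t_\lambda t_\mu=t_{\lambda\mu}$ if $s(\lambda)=r(\mu)$; (iii) $t_\lambda^*t_\mu=\sum_{(\alpha,\beta)\in\Lambda^{\min}(\lambda,\mu)}t_\alpha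 t_\beta^*$ for all $\lambda,\mu$; (iv) $\prod_{\lambda\in E}(t_v-t_\lambda t_\lambda^*)=0$ for every vertex $v$ and every finite exhaustive set $E$ of paths with range $v$. Let $C^*(\Lambda)$ be the universal $C^*$-algebra generated by a Cuntz–Krieger $\Lambda$-family $\{s_\lambda\}$: for every Cuntz–Krieger $\Lambda$-family $\{t_\lambda\}$ in a $C^*$-algebra $B$ there is a unique $*$-homomorphism $\pi_t:C^*(\Lambda)\to B$ with $\pi_t(s_\lambda)=t_\lambda$ for all $\lambda$. Let $\gamma$ be the gauge action of $\mathbb T^k$ on $C^*(\Lambda)$ by automorphisms, determined by $\gamma_z(s_\lambda)=z^{d(\lambda)}s_\lambda$ with $z^m=z_1^{m_1}\cdots z_k^{m_k}$, and let $C^*(\Lambda)^\gamma=\{a:\gamma_z(a)=a\text{ for all }z\in\mathbb T^k\}$ be its fixed-point algebra, the core. **Theorem.** Let $(\Lambda,d)$ be a finitely aligned $k$-graph. Then $C^*(\Lambda)^\gamma$ is AF, i.e. it is the closure of the union of an increasing sequence of finite-dimensional $C^*$-subalgebras. Moreover, if $\{t_\lambda:\lambda\in\Lambda\}$ is a Cuntz–Krieger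 $\Lambda$-family with $t_v\neq0$ for every vertex $v$, then the homomorphism $\pi_t$ is injective on $C^*(\Lambda)^\gamma$. -/

import Mathlib

open CategoryTheory
open scoped ENNReal

universe u v w

noncomputable section

/-- A path of a small category `V`, i.e. a morphism together with its source (domain) and
its range (codomain). -/
@[ext]
structure KPath (V : Type u) [Category.{v} V] where
  src : V
  rng : V
  hom : src ⟶ rng

namespace KPath

variable {V : Type u} [Category.{v} V]

/-- The vertex `a`, regarded as the identity morphism of `a`. -/
def vertex (a : V) : KPath V := ⟨a, a, 𝟙 a⟩

/-- The product `x y` of two paths with `s(x) = r(y)`: first `y`, then `x`. -/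
def comp (x y : KPath V) (h : x.src = y.rng) : KPath V :=
  ⟨y.src, x.rng, y.hom ≫ eqToHom h.symm ≫ x.hom⟩

end KPath

/-- A `k`-graph: a countable small category with a degree functor to the monoid `ℕ^k`
which has the factorisation property. -/
class KGraph (k : ℕ) (V : Type u) [Category.{v} V] where
  countable_path : Countable (KPath V)
  deg : KPath V → (Fin k → ℕ)
  deg_vertex : ∀ a : V, deg (KPath.vertex a) = 0
  deg_comp : ∀ (x y : KPath V) (h : x.src = y.rng), deg (x.comp y h) = deg x + deg y
  factorisation : ∀ (x : KPath V) (m n : Fin k → ℕ), deg x = m + n →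
    ∃! p : KPath V × KPath V,
      deg p.1 = m ∧ deg p.2 = n ∧ ∃ h : p.1.src = p.2.rng, p.1.comp p.2 h = x

namespace KGraph

variable (k : ℕ) {V : Type u} [Category.{v} V] [KGraph k V]

/-- `Λ^min(x, y)`: the pairs `(α, β)` of paths such that `x α = y β` is a minimal common
extension of `x` and `y`, i.e. has degree `d(x) ∨ d(y)`. -/
def minExt (x y : KPath V) : Set (KPath V × KPath V) :=
  {p | ∃ (h₁ : x.src = p.1.rng) (h₂ : y.src = p.2.rng),
    x.comp p.1 h₁ = y.comp p.2 h₂ ∧ deg (k := k) (x.comp p.1 h₁) = deg x ⊔ deg y}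

variable (V) in
/-- The `k`-graph is finitely aligned: all the sets `Λ^min(x, y)` are finite. -/
class FinitelyAligned : Prop where
  finite_minExt : ∀ x y : KPath V, (minExt k x y).Finite

/-- A set `E` of paths with range `a` is exhaustive if every path with range `a` has a
(minimal) common extension with a member of `E`. -/
def Exhaustive (a : V) (E : Set (KPath V)) : Prop :=
  (∀ x ∈ E, x.rng = a) ∧ ∀ y : KPath V, y.rng = a → ∃ x ∈ E, (minExt k x y).Nonempty

/-- The product of the elements `t_a - t_x t_x^*`, where `x` runs through the list `l`, in the
order of the list. The algebra need not have a unit; the last factor `t_a` is a right unit for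
each of the factors `t_a - t_x t_x^*` with `r(x) = a` if `t` satisfies the first two
Cuntz-Krieger relations, so it does not change the product of a non-empty list. -/
def gapProd {A : Type*} [NonUnitalCStarAlgebra A] (t : KPath V → A) (a : V)
    (l : List (KPath V)) : A :=
  l.foldr (fun x c => (t (KPath.vertex a) - t x * star (t x)) * c) (t (KPath.vertex a))

variable [FinitelyAligned k V]

/-- Cuntz-Krieger families of a finitely aligned `k`-graph in a C*-algebra. In `gap` the finite
exhaustive set `E` is given by an enumeration of its elements without repetitions; an exhaustive
set is never empty, since `a` itself is a path with range `a`, and the factors of the product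
commute if the other relations hold. -/
structure IsCKFamily {A : Type*} [NonUnitalCStarAlgebra A] (t : KPath V → A) : Prop where
  partialIsometry : ∀ x, t x * star (t x) * t x = t x
  projection : ∀ a : V, IsStarProjection (t (KPath.vertex a))
  orthogonal : ∀ a b : V, a ≠ b → t (KPath.vertex a) * t (KPath.vertex b) = 0
  mul : ∀ (x y : KPath V) (h : x.src = y.rng), t x * t y = t (x.comp y h)
  star_mul : ∀ x y : KPath V, star (t x) * t y =
    ∑ p ∈ (FinitelyAligned.finite_minExt (k := k) x y).toFinset, t p.1 * star (t p.2)
  gap : ∀ (a : V) (l : List (KPath V)), l.Nodup → Exhaustive k a {x | x ∈ l} →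
    gapProd t a l = 0

variable {k}

theorem map_gapProd {A B : Type*} [NonUnitalCStarAlgebra A] [NonUnitalCStarAlgebra B]
    (φ : A →⋆ₙₐ[ℂ] B) (t : KPath V → A) (a : V) (l : List (KPath V)) :
    φ (gapProd t a l) = gapProd (fun x => φ (t x)) a l := by
  induction l with
  | nil => rfl
  | cons x l ih =>
    simp only [gapProd, List.foldr_cons, map_mul, map_sub, map_star] at ih ⊢
    rw [ih]

/-- Being a Cuntz-Krieger family can be tested after a jointly injective family of
homomorphisms. -/
theorem IsCKFamily.of_maps {A : Type*} [NonUnitalCStarAlgebra A] {ι : Type*} {B : ι → Type*}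
    [∀ i, NonUnitalCStarAlgebra (B i)] (φ : ∀ i, A →⋆ₙₐ[ℂ] B i)
    (hφ : ∀ a b, (∀ i, φ i a = φ i b) → a = b) {t : KPath V → A}
    (h : ∀ i, IsCKFamily k (fun x => φ i (t x))) : IsCKFamily k t where
  partialIsometry x := hφ _ _ fun i => by
    rw [map_mul, map_mul, map_star (φ i)]; exact (h i).partialIsometry x
  projection a :=
    ⟨hφ _ _ fun i => by rw [map_mul]; exact ((h i).projection a).isIdempotentElem.eq,
      hφ _ _ fun i => by rw [map_star (φ i)]; exact ((h i).projection a).isSelfAdjoint.star_eq⟩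
  orthogonal a b hab := hφ _ _ fun i => by
    rw [map_mul, map_zero]; exact (h i).orthogonal a b hab
  mul x y hxy := hφ _ _ fun i => by rw [map_mul]; exact (h i).mul x y hxy
  star_mul x y := hφ _ _ fun i => by
    rw [map_mul, map_star (φ i), map_sum]
    simp only [map_mul]
    refine ((h i).star_mul x y).trans (Finset.sum_congr rfl fun p _ => ?_)
    rw [map_star (φ i)]
  gap a l hl hE := hφ _ _ fun i => by
    rw [map_gapProd, map_zero]; exact (h i).gap a l hl hE

theorem IsCKFamily.norm_le_one {A : Type*} [NonUnitalCStarAlgebra A] {t : KPath V → A}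
    (h : IsCKFamily k t) (x : KPath V) : ‖t x‖ ≤ 1 := by
  have hp : IsStarProjection (star (t x) * t x) := by
    refine ⟨?_, IsSelfAdjoint.star_mul_self _⟩
    change star (t x) * t x * (star (t x) * t x) = star (t x) * t x
    rw [mul_assoc, ← mul_assoc (t x), h.partialIsometry]
  have h1 := hp.norm_le
  rw [CStarRing.norm_star_mul_self] at h1
  nlinarith [norm_nonneg (t x)]

variable (k V) in
/-- A Cuntz-Krieger family together with the C*-algebra in which it lives. Up to isomorphism
of the generated C*-algebras these are all Cuntz-Krieger families (see `CStar.lift`). -/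
structure Rep : Type (max u v 1) where
  Alg : Type
  [inst : NonUnitalCStarAlgebra Alg]
  fam : KPath V → Alg
  isCK : IsCKFamily k fam

attribute [instance] Rep.inst

variable (k V) in
/-- The C*-algebra of all bounded families in the product of the target algebras of all
Cuntz-Krieger families. -/
abbrev RepProd : Type (max u v 1) := lp (fun i : Rep k V => i.Alg) ∞

variable (k) in
/-- The family `s_x = (t_x)_t`, where `t` runs through all Cuntz-Krieger families. -/
def prodFam (x : KPath V) : RepProd k V :=
  ⟨fun i => i.fam x, memℓp_infty ⟨1, by rintro _ ⟨i, rfl⟩; exact i.isCK.norm_le_one x⟩⟩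

/-- The coordinate projections of the product. -/
def coord (i : Rep k V) : RepProd k V →⋆ₙₐ[ℂ] i.Alg where
  toFun a := a.1 i
  map_smul' _ _ := rfl
  map_zero' := rfl
  map_add' _ _ := rfl
  map_mul' _ _ := rfl
  map_star' _ := rfl

theorem isCKFamily_prodFam : IsCKFamily k (prodFam k : KPath V → RepProd k V) :=
  .of_maps coord (fun _ _ h => Subtype.ext (funext h)) fun i => i.isCK

variable (k V) in
/-- The closed *-subalgebra of the product generated by the elements `s_x`. -/
def cstarSubalgebra : NonUnitalStarSubalgebra ℂ (RepProd k V) :=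
  (NonUnitalStarAlgebra.adjoin ℂ (Set.range (prodFam k))).topologicalClosure

instance : IsClosed (cstarSubalgebra k V : Set (RepProd k V)) :=
  NonUnitalStarSubalgebra.isClosed_topologicalClosure _

variable (k V) in
/-- The C*-algebra `C*(Λ)` of a finitely aligned `k`-graph `Λ`: the universal C*-algebra
generated by a Cuntz-Krieger family. -/
abbrev CStar : Type (max u v 1) := cstarSubalgebra k V

namespace CStar

variable (k) in
/-- The universal Cuntz-Krieger family `s` in `C*(Λ)`. -/
def gen (x : KPath V) : CStar k V :=
  ⟨prodFam k x, NonUnitalStarSubalgebra.le_topologicalClosure _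
    (NonUnitalStarAlgebra.subset_adjoin ℂ _ ⟨x, rfl⟩)⟩

theorem isCKFamily_gen : IsCKFamily k (gen k : KPath V → CStar k V) :=
  .of_maps (fun _ : Unit => NonUnitalStarSubalgebraClass.subtype (cstarSubalgebra k V))
    (fun _ _ h => Subtype.ext (h ())) fun _ => isCKFamily_prodFam

/-- Two homomorphisms which agree on the elements `s_x` are equal. -/
theorem hom_ext {B : Type*} [NonUnitalCStarAlgebra B] {φ ψ : CStar k V →⋆ₙₐ[ℂ] B}
    (h : ∀ x, φ (gen k x) = ψ (gen k x)) : φ = ψ := by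
  have hφ : Continuous φ := (NonUnitalStarAlgHom.instContinuousLinearMapClassComplex).map_continuous φ
  have hψ : Continuous ψ := (NonUnitalStarAlgHom.instContinuousLinearMapClassComplex).map_continuous ψ
  have key : ∀ (a : RepProd k V) (ha : a ∈ NonUnitalStarAlgebra.adjoin ℂ (Set.range (prodFam k))),
      φ ⟨a, NonUnitalStarSubalgebra.le_topologicalClosure _ ha⟩ =
        ψ ⟨a, NonUnitalStarSubalgebra.le_topologicalClosure _ ha⟩ := by
    intro a ha
    induction ha using NonUnitalStarAlgebra.adjoin_induction with
    | mem a ha => obtain ⟨x, rfl⟩ := ha; exact h x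
    | add a b ha hb iha ihb =>
      have := congrArg₂ (· + ·) iha ihb
      simp only [← map_add] at this
      exact this
    | zero => exact (map_zero φ).trans (map_zero ψ).symm
    | mul a b ha hb iha ihb =>
      have := congrArg₂ (· * ·) iha ihb
      simp only [← map_mul] at this
      exact this
    | smul r a ha iha =>
      have := congrArg (r • ·) iha
      simp only [← map_smul] at this
      exact this
    | star a ha iha =>
      have := congrArg star iha
      simp only [← map_star] at this
      exact this
  have hd : DenseRange (fun a : NonUnitalStarAlgebra.adjoin ℂ (Set.range (prodFam (V := V) k)) =>
      (⟨a.1, NonUnitalStarSubalgebra.le_topologicalClosure _ a.2⟩ : CStar k V)) := by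
    intro a
    rw [closure_subtype]
    have hr : Subtype.val '' Set.range
        (fun a : NonUnitalStarAlgebra.adjoin ℂ (Set.range (prodFam (V := V) k)) =>
          (⟨a.1, NonUnitalStarSubalgebra.le_topologicalClosure _ a.2⟩ : CStar k V)) =
        (NonUnitalStarAlgebra.adjoin ℂ (Set.range (prodFam (V := V) k)) : Set (RepProd k V)) := by
      ext b
      constructor
      · rintro ⟨_, ⟨c, rfl⟩, rfl⟩; exact c.2
      · intro hb; exact ⟨_, ⟨⟨b, hb⟩, rfl⟩, rfl⟩
    rw [hr]
    exact a.2
  refine DFunLike.coe_injective (hd.equalizer hφ hψ (funext fun a => key a.1 a.2))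

end CStar

/-- A C*-algebra with a small underlying type has an isomorphic copy in `Type`. -/
theorem exists_copy (B : Type w) [NonUnitalCStarAlgebra B] [Small.{0} B] :
    ∃ (A : Type) (_ : NonUnitalCStarAlgebra A), Nonempty (A ≃⋆ₐ[ℂ] B) := by
  let e : Shrink.{0} B ≃ B := (equivShrink B).symm
  let r : NonUnitalRing (Shrink.{0} B) := e.nonUnitalRing
  let st : StarRing (Shrink.{0} B) := e.starRing
  let md : Module ℂ (Shrink.{0} B) := e.module ℂ
  have hadd : ∀ a b, e (a + b) = e a + e b := fun a b => e.apply_symm_apply _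
  have hmul : ∀ a b, e (a * b) = e a * e b := fun a b => e.apply_symm_apply _
  have hsm : ∀ (c : ℂ) a, e (c • a) = c • e a := fun c a => e.apply_symm_apply _
  have hst : ∀ a, e (star a) = star (e a) := fun a => e.apply_symm_apply _
  have hz : e 0 = 0 := e.apply_symm_apply _
  let f : Shrink.{0} B →ₙ+* B :=
    { toFun := e, map_mul' := hmul, map_add' := hadd, map_zero' := hz }
  let nr : NonUnitalNormedRing (Shrink.{0} B) := .induced _ B f e.injective
  have hn : ∀ a : Shrink.{0} B, ‖a‖ = ‖e a‖ := fun _ => rfl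
  have hiso : Isometry e := Isometry.of_dist_eq fun a b => rfl
  let : NonUnitalCStarAlgebra (Shrink.{0} B) :=
    { nr, st, md with
      complete := ((hiso.isUniformInducing.completeSpace_congr e.surjective).2 inferInstance).complete
      norm_mul_self_le := fun a => by
        rw [hn, hn, hmul, hst]; exact CStarRing.norm_mul_self_le _
      norm_smul_le := fun c a => by
        rw [hn, hn, hsm]; exact norm_smul_le _ _
      smul_assoc := fun c a b => e.injective <| by
        simp only [smul_eq_mul, hsm, hmul, smul_mul_assoc]
      smul_comm := fun c a b => e.injective <| by
        simp only [smul_eq_mul, hsm, hmul, mul_smul_comm]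
      star_smul := fun c a => e.injective <| by simp only [hst, hsm, star_smul] }
  exact ⟨Shrink.{0} B, inferInstance, ⟨{ e with
    map_mul' := hmul, map_add' := hadd, map_smul' := hsm, map_star' := hst }⟩⟩

/-- The closed *-subalgebra generated by countably many elements is small. -/
theorem small_closure_adjoin {B : Type w} [NonUnitalCStarAlgebra B] {S : Set B}
    (hS : S.Countable) : Small.{0} (NonUnitalStarAlgebra.adjoin ℂ S).topologicalClosure := by
  have hSS : (S ∪ star S).Countable := by
    refine hS.union ?_
    rw [← Set.image_star]; exact hS.image _
  have hc : (Subsemigroup.closure (S ∪ star S) : Set B).Countable := by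
    have : Countable (S ∪ star S : Set B) := hSS.to_subtype
    have : Countable (FreeSemigroup (S ∪ star S : Set B)) :=
      Function.Injective.countable (f := fun a => (a.head, a.tail)) (by
        rintro ⟨a, l⟩ ⟨b, m⟩ h; simpa using h)
    refine (Set.countable_range
      (FreeSemigroup.lift (fun a : (S ∪ star S : Set B) => (a : B)))).mono ?_
    have : Subsemigroup.closure (S ∪ star S) ≤
        (FreeSemigroup.lift (fun a : (S ∪ star S : Set B) => (a : B))).srange :=
      Subsemigroup.closure_le.2 fun a ha => ⟨FreeSemigroup.of ⟨a, ha⟩, by simp⟩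
    exact this
  have hsep : TopologicalSpace.IsSeparable
      ((NonUnitalStarAlgebra.adjoin ℂ S).topologicalClosure : Set B) := by
    change TopologicalSpace.IsSeparable (closure _)
    refine TopologicalSpace.IsSeparable.closure ?_
    have := hc.isSeparable.span (R := ℂ)
    rw [← NonUnitalStarAlgebra.adjoin_eq_span] at this
    exact this
  have hcl : IsClosed ((NonUnitalStarAlgebra.adjoin ℂ S).topologicalClosure : Set B) :=
    NonUnitalStarSubalgebra.isClosed_topologicalClosure _
  have : SecondCountableTopology (NonUnitalStarAlgebra.adjoin ℂ S).topologicalClosure :=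
    hsep.secondCountableTopology
  have : CompleteSpace (NonUnitalStarAlgebra.adjoin ℂ S).topologicalClosure :=
    hcl.completeSpace_coe
  obtain ⟨f, -, hf⟩ := exists_nat_nat_continuous_surjective_of_completeSpace
    (NonUnitalStarAlgebra.adjoin ℂ S).topologicalClosure
  exact small_of_surjective hf

namespace CStar

theorem exists_lift {B : Type w} [NonUnitalCStarAlgebra B] {t : KPath V → B}
    (ht : IsCKFamily k t) : ∃ φ : CStar k V →⋆ₙₐ[ℂ] B, ∀ x, φ (gen k x) = t x := by
  let D := (NonUnitalStarAlgebra.adjoin ℂ (Set.range t)).topologicalClosure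
  have hcl : IsClosed (D : Set B) := NonUnitalStarSubalgebra.isClosed_topologicalClosure _
  have : Countable (KPath V) := KGraph.countable_path k
  have : Small.{0} D := small_closure_adjoin (Set.countable_range t)
  obtain ⟨A, iA, ⟨e⟩⟩ := exists_copy D
  let ι : D →⋆ₙₐ[ℂ] B := NonUnitalStarSubalgebraClass.subtype D
  let e₁ : A →⋆ₙₐ[ℂ] D := (e : A →⋆ₙₐ[ℂ] D)
  have hmem : ∀ x, t x ∈ D := fun x => NonUnitalStarSubalgebra.le_topologicalClosure _
    (NonUnitalStarAlgebra.subset_adjoin ℂ _ ⟨x, rfl⟩)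
  let t' : KPath V → A := fun x => e.symm ⟨t x, hmem x⟩
  have hval : ∀ x, (ι.comp e₁) (t' x) = t x := fun x =>
    congrArg Subtype.val (e.apply_symm_apply ⟨t x, hmem x⟩)
  have ht' : IsCKFamily k t' :=
    .of_maps (fun _ : Unit => ι.comp e₁)
      (fun a b h => e.injective (Subtype.ext (h ()))) fun _ => by simpa only [hval] using ht
  let i : Rep k V := ⟨A, t', ht'⟩
  exact ⟨(ι.comp e₁).comp ((coord i).comp
    (NonUnitalStarSubalgebraClass.subtype (cstarSubalgebra k V))), hval⟩

/-- The universal property: the homomorphism `π_t` with `π_t(s_x) = t_x` induced by a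
Cuntz-Krieger family `t` in an arbitrary C*-algebra. It is unique by `hom_ext`. -/
def lift {B : Type w} [NonUnitalCStarAlgebra B] {t : KPath V → B} (ht : IsCKFamily k t) :
    CStar k V →⋆ₙₐ[ℂ] B :=
  (exists_lift ht).choose

@[simp]
theorem lift_gen {B : Type w} [NonUnitalCStarAlgebra B] {t : KPath V → B}
    (ht : IsCKFamily k t) (x : KPath V) : lift ht (gen k x) = t x :=
  (exists_lift ht).choose_spec x

end CStar

variable (k) in
/-- `z^{d(x)} = z_1^{d(x)_1} ⋯ z_k^{d(x)_k}` for `z` in the torus `𝕋^k`. -/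
def gaugeCoeff (z : Fin k → Circle) (x : KPath V) : Circle :=
  ∏ i, z i ^ KGraph.deg (k := k) x i

/-- `x ↦ z^{d(x)} t_x` is a Cuntz-Krieger family if `t` is. -/
theorem IsCKFamily.gauge {A : Type*} [NonUnitalCStarAlgebra A] {t : KPath V → A}
    (h : IsCKFamily k t) (z : Fin k → Circle) :
    IsCKFamily k (fun x => (gaugeCoeff k z x : ℂ) • t x) := by
  have hv : ∀ a : V, (gaugeCoeff k z (KPath.vertex a) : ℂ) = 1 := fun a => by
    simp [gaugeCoeff, KGraph.deg_vertex]
  have hc : ∀ (x y : KPath V) (hxy : x.src = y.rng), (gaugeCoeff k z (x.comp y hxy) : ℂ) =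
      gaugeCoeff k z x * gaugeCoeff k z y := fun x y hxy => by
    rw [← Circle.coe_mul]
    simp [gaugeCoeff, KGraph.deg_comp, pow_add, Finset.prod_mul_distrib]
  have h1 : ∀ x : KPath V, (gaugeCoeff k z x : ℂ) * star (gaugeCoeff k z x : ℂ) = 1 := fun x => by
    rw [← starRingEnd_apply, Complex.mul_conj]; simp
  have ht : ∀ x : KPath V, ((gaugeCoeff k z x : ℂ) • t x) *
      star ((gaugeCoeff k z x : ℂ) • t x) = t x * star (t x) := fun x => by
    rw [star_smul, smul_mul_smul_comm, h1, one_smul]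
  refine ⟨fun x => ?_, fun a => ?_, fun a b hab => ?_, fun x y hxy => ?_, fun x y => ?_,
    fun a l hl hE => ?_⟩
  · simp only [ht, mul_smul_comm, h.partialIsometry]
  · simpa only [hv, one_smul] using h.projection a
  · simpa only [hv, one_smul] using h.orthogonal a b hab
  · simp only [smul_mul_smul_comm, h.mul x y hxy, hc]
  · simp only [star_smul, smul_mul_smul_comm, h.star_mul, Finset.smul_sum]
    refine Finset.sum_congr rfl fun p hp => ?_
    obtain ⟨hx, hy, he, -⟩ := (Set.Finite.mem_toFinset _).1 hp
    have e1 : (gaugeCoeff k z x : ℂ) * gaugeCoeff k z p.1 =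
        gaugeCoeff k z y * gaugeCoeff k z p.2 := by rw [← hc x p.1 hx, ← hc y p.2 hy, he]
    congr 1
    linear_combination (star (gaugeCoeff k z x : ℂ) * star (gaugeCoeff k z p.2 : ℂ)) * -e1 +
      gaugeCoeff k z p.1 * star (gaugeCoeff k z p.2 : ℂ) * h1 x -
      gaugeCoeff k z y * star (gaugeCoeff k z x : ℂ) * h1 p.2
  · have : gapProd (fun x => (gaugeCoeff k z x : ℂ) • t x) a l = gapProd t a l := by
      simp only [gapProd, ht, hv, one_smul]
    rw [this, h.gap a l hl hE]

namespace CStar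

variable (k V) in
/-- The gauge action `γ` of `𝕋^k` on `C*(Λ)`, determined by `γ_z(s_x) = z^{d(x)} s_x`. -/
def gaugeAction : (Fin k → Circle) →* (CStar k V ≃⋆ₐ[ℂ] CStar k V) :=
  let g (z : Fin k → Circle) : CStar k V →⋆ₙₐ[ℂ] CStar k V := lift (isCKFamily_gen.gauge z)
  have hg (z : Fin k → Circle) (x : KPath V) : g z (gen k x) = (gaugeCoeff k z x : ℂ) • gen k x :=
    lift_gen _ x
  have g1 (a) : g 1 a = a := DFunLike.congr_fun (g := NonUnitalStarAlgHom.id ℂ (CStar k V))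
    (hom_ext fun x => by rw [hg]; simp [gaugeCoeff]) a
  have gm (z w a) : g (z * w) a = g z (g w a) := DFunLike.congr_fun (g := (g z).comp (g w))
    (hom_ext fun x => by
      rw [NonUnitalStarAlgHom.comp_apply, hg, hg, map_smul, hg, smul_smul, ← Circle.coe_mul]
      simp [gaugeCoeff, mul_pow, Finset.prod_mul_distrib, mul_comm]) a
  have gi (z a) : g z⁻¹ (g z a) = a := by rw [← gm, inv_mul_cancel, g1]
  have gj (z a) : g z (g z⁻¹ a) = a := by rw [← gm, mul_inv_cancel, g1]
  { toFun z :=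
      { toFun := g z
        invFun := g z⁻¹
        left_inv := gi z
        right_inv := gj z
        map_mul' := map_mul (g z)
        map_add' := map_add (g z)
        map_star' := map_star (g z)
        map_smul' := map_smul (g z) }
    map_one' := StarAlgEquiv.ext g1
    map_mul' z w := StarAlgEquiv.ext (gm z w) }

theorem gaugeAction_gen (z : Fin k → Circle) (x : KPath V) :
    gaugeAction k V z (gen k x) = (gaugeCoeff k z x : ℂ) • gen k x :=
  lift_gen _ x

variable (k V) in
/-- The core `C*(Λ)^γ`: the fixed-point algebra of the gauge action. -/
def core : NonUnitalStarSubalgebra ℂ (CStar k V) where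
  carrier := {a | ∀ z, gaugeAction k V z a = a}
  add_mem' ha hb z := by rw [map_add, ha z, hb z]
  zero_mem' z := map_zero _
  mul_mem' ha hb z := by rw [map_mul, ha z, hb z]
  smul_mem' c a ha z := by rw [map_smul, ha z]
  star_mem' ha z := by rw [map_star, ha z]

instance : IsClosed (core k V : Set (CStar k V)) := by
  have : (core k V : Set (CStar k V)) = ⋂ z, {a | gaugeAction k V z a = a} := by
    ext a; simp only [Set.mem_iInter, SetLike.mem_coe]; rfl
  rw [this]
  exact isClosed_iInter fun z =>
    isClosed_eq (StarAlgEquiv.isometry (gaugeAction k V z)).continuous continuous_id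

end CStar

end KGraph

/-- A C*-algebra is AF (approximately finite-dimensional) if it is the closure of the union of
an increasing sequence of finite-dimensional *-subalgebras. -/
def IsAF (A : Type*) [NonUnitalCStarAlgebra A] : Prop :=
  ∃ F : ℕ → NonUnitalStarSubalgebra ℂ A, Monotone F ∧ (∀ n, FiniteDimensional ℂ (F n)) ∧
    Dense (⋃ n, (F n : Set A))

end

/-! By relation (iii), `t_l t_m^* t_s t_r^*` is the sum of `t_{lα} t_{rβ}^*` over `(α, β)` in
`Λ^min(m, s)`. Hence the elements `t_l t_m^*` with `l, m` in `E`, `d(l) = d(m)` and `s(l) = s(m)`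
span a *-algebra once `E` is saturated (`pairAlgebra`). A finite set of paths has a finite
saturation (`finite_saturation`) and there are countably many paths, so the core contains an
increasing sequence of finite-dimensional *-algebras. Their union is dense (`core_subset_closure`):
averaging the gauge action over roots of unity of large order is contractive, fixes the core and
kills `s_l s_m^*` when `d(l) ≠ d(m)`.

For injectivity, let `φ` be nonzero on vertices, let `E` be finite and saturated, and let `a ≠ 0` in
its algebra satisfy `φ(a) = 0`. Choose `l, m` in `E` of maximal total degree with `c = t_l^* a t_m ≠
0`. By maximality `c` is fixed by the gap projections of the proper extensions of `l` and `m` inside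
`E`, and compression by these turns `c` into a multiple of a single gap projection
(`gapProj_mul_mem_span`). So `φ` kills that projection. This forces the extensions to be exhaustive,
and relation (iv) gives `c = 0`, a contradiction (`eq_zero_of_map_eq_zero`). Thus `φ` is injective,
hence isometric, on each finite-dimensional algebra, and isometry passes to the closure. -/

namespace KPath

variable {V : Type u} [Category.{v} V]

/-! ### Composition of paths -/

theorem comp_assoc (x y z : KPath V) (h : x.src = y.rng) (h' : y.src = z.rng) :
    (x.comp y h).comp z h' = x.comp (y.comp z h') h := by
  obtain ⟨a, b, f⟩ := x
  obtain ⟨c, d, g⟩ := y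
  obtain ⟨e, i, j⟩ := z
  dsimp at h h'
  subst h h'
  change KPath.mk e b (j ≫ 𝟙 c ≫ g ≫ 𝟙 a ≫ f) = KPath.mk e b ((j ≫ 𝟙 c ≫ g) ≫ 𝟙 a ≫ f)
  simp

theorem comp_vertex (x : KPath V) {a : V} (h : x.src = a) : x.comp (vertex a) h = x := by
  subst h
  simp [comp, vertex]

theorem vertex_comp (x : KPath V) {a : V} (h : a = x.rng) : (vertex a).comp x h = x := by
  subst h
  simp [comp, vertex]

end KPath

namespace KGraph

/-! ### Unique factorisation and minimal common extensions -/

variable {k : ℕ} {V : Type u} [Category.{v} V] [KGraph k V]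

variable (k) in
theorem comp_inj {x y x' y' : KPath V} {h : x.src = y.rng} {h' : x'.src = y'.rng}
    (e : x.comp y h = x'.comp y' h') (hd : deg (k := k) x = deg x') : x = x' ∧ y = y' := by
  have hy : deg (k := k) y = deg y' := by
    have := congrArg (deg (k := k)) e
    rw [deg_comp, deg_comp, hd] at this
    exact add_left_cancel this
  have := (factorisation (k := k) (x.comp y h) _ _ (deg_comp x y h)).unique
    (y₁ := (x, y)) (y₂ := (x', y')) ⟨rfl, rfl, h, rfl⟩ ⟨hd.symm, hy.symm, h', e.symm⟩
  exact Prod.mk.inj this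

theorem comp_left_cancel (k : ℕ) [KGraph k V] {x y y' : KPath V} {h : x.src = y.rng}
    {h' : x.src = y'.rng}
    (e : x.comp y h = x.comp y' h') : y = y' :=
  (comp_inj k e rfl).2

theorem exists_factor (x : KPath V) {m : Fin k → ℕ} (hm : m ≤ deg (k := k) x) :
    ∃ (p q : KPath V) (h : p.src = q.rng), p.comp q h = x ∧ deg (k := k) p = m := by
  obtain ⟨⟨p, q⟩, ⟨hp, -, h, e⟩, -⟩ := factorisation (k := k) x m (deg (k := k) x - m)
    (add_tsub_cancel_of_le hm).symm
  exact ⟨p, q, h, e, hp⟩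

/-- Both `x` and `r(x)` are initial segments of degree zero of the path `x`, so they agree by
uniqueness. -/
theorem eq_vertex_of_deg_eq_zero {x : KPath V} (hx : deg (k := k) x = 0) :
    x = KPath.vertex x.rng := by
  have e : x.comp (KPath.vertex x.src) rfl = (KPath.vertex x.rng).comp x rfl := by
    exact (KPath.comp_vertex x rfl).trans (KPath.vertex_comp x rfl).symm
  exact (comp_inj k e (by rw [hx, deg_vertex])).1

theorem comp_eq_self {x y : KPath V} (h : x.src = y.rng) (hy : deg (k := k) y = 0) :
    x.comp y h = x := by
  have := eq_vertex_of_deg_eq_zero hy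
  revert h
  rw [this]
  exact fun h => KPath.comp_vertex x h

theorem deg_le_comp_left (x y : KPath V) (h : x.src = y.rng) :
    deg (k := k) x ≤ deg (x.comp y h) := by
  rw [deg_comp]; exact le_self_add

theorem minExt_symm {x y : KPath V} {p q : KPath V} (h : (p, q) ∈ minExt k x y) :
    (q, p) ∈ minExt k y x := by
  obtain ⟨h₁, h₂, e, hd⟩ := h
  exact ⟨h₂, h₁, e.symm, by rw [← e, hd, sup_comm]⟩

theorem src_eq_of_mem_minExt {x y : KPath V} {p q : KPath V} (h : (p, q) ∈ minExt k x y) :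
    p.src = q.src := by
  obtain ⟨h₁, h₂, e, -⟩ := h
  have := congrArg KPath.src e
  exact this

theorem minExt_self (x : KPath V) :
    minExt k x x = {(KPath.vertex x.src, KPath.vertex x.src)} := by
  ext ⟨p, q⟩
  constructor
  · rintro ⟨h₁, h₂, e, hd⟩
    have hpq := comp_left_cancel k e
    dsimp at h₁ h₂ hpq hd
    subst hpq
    rw [deg_comp, sup_idem] at hd
    have := eq_vertex_of_deg_eq_zero (k := k) (x := p) (by simpa using hd)
    rw [← h₁] at this
    simp [this]
  · rintro h
    obtain ⟨rfl, rfl⟩ := Prod.mk.inj h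
    exact ⟨rfl, rfl, rfl, by rw [KPath.comp_vertex]; simp⟩

/-- The common extension of two initial segments `x`, `y` of a path, of degree `d(x) ∨ d(y)`. -/
theorem exists_minExt_of_comp_eq {x y a b : KPath V} {h : x.src = a.rng} {h' : y.src = b.rng}
    (e : x.comp a h = y.comp b h') :
    ∃ (p q r : KPath V) (_ : (p, q) ∈ minExt k x y) (hp : p.src = r.rng) (hq : q.src = r.rng),
      p.comp r hp = a ∧ q.comp r hq = b := by
  have hx := deg_le_comp_left (k := k) x a h
  have hy : deg (k := k) y ≤ deg (x.comp a h) := e ▸ deg_le_comp_left (k := k) y b h'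
  -- `z` is the initial segment of degree `d(x) ∨ d(y)` of the common path; `p` and `q` complete `x`
  -- and `y` to `z`, and `r` is the rest.
  obtain ⟨z, r, hz, ez, dz⟩ := exists_factor _ (sup_le hx hy)
  obtain ⟨x', p, hp, ep, dx⟩ := exists_factor (k := k) z (m := deg x) (dz ▸ le_sup_left)
  obtain ⟨y', q, hq, eq, dy⟩ := exists_factor (k := k) z (m := deg y) (dz ▸ le_sup_right)
  have hpr : p.src = r.rng := by rw [← hz, ← ep]; rfl
  have hqr : q.src = r.rng := by rw [← hz, ← eq]; rfl
  have e1 : x'.comp (p.comp r hpr) hp = x.comp a h := by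
    rw [← KPath.comp_assoc, ← ez]; congr 1
  have e2 : y'.comp (q.comp r hqr) hq = y.comp b h' := by
    rw [← KPath.comp_assoc, ← e, ← ez]; congr 1
  obtain ⟨rfl, rfl⟩ := comp_inj k e1 dx
  obtain ⟨rfl, rfl⟩ := comp_inj k e2 dy
  exact ⟨p, q, r, ⟨hp, hq, ep.trans eq.symm, by rw [← dz, ← ep]⟩, hpr, hqr, rfl, rfl⟩

theorem mem_minExt_of_comp_eq {x y a : KPath V} {h : x.src = a.rng} (e : x.comp a h = y) :
    (a, KPath.vertex y.src) ∈ minExt k x y := by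
  subst e
  refine ⟨h, rfl, by rw [KPath.comp_vertex], ?_⟩
  exact (sup_eq_right.2 (deg_le_comp_left x a h)).symm

/-- A tail of a given path is determined by its degree, which is bounded by that of the path. -/
theorem finite_tails (k : ℕ) [KGraph k V] {A : Set (KPath V)} (hA : A.Finite) :
    {r : KPath V | ∃ (p : KPath V) (h : p.src = r.rng), p.comp r h ∈ A}.Finite := by
  have key (x : KPath V) :
      {r : KPath V | ∃ (p : KPath V) (h : p.src = r.rng), p.comp r h = x}.Finite := by
    refine Set.Finite.of_finite_image (f := deg (k := k))
      ((Set.finite_Iic (deg (k := k) x)).subset ?_) ?_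
    · rintro _ ⟨r, ⟨p, h, rfl⟩, rfl⟩
      rw [Set.mem_Iic, deg_comp]
      exact le_add_self
    · rintro r ⟨p, h, e⟩ r' ⟨p', h', e'⟩ hr
      refine (comp_inj k (e.trans e'.symm) ?_).2
      have := congrArg (deg (k := k)) (e.trans e'.symm)
      rw [deg_comp, deg_comp, hr] at this
      exact add_right_cancel this
  refine (hA.biUnion fun x _ => key x).subset ?_
  rintro r ⟨p, h, hr⟩
  exact Set.mem_biUnion hr ⟨p, h, rfl⟩

/-! ### Saturated sets of paths -/

variable (k) in
/-- The total degree of a path. -/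
def size (x : KPath V) : ℕ := ∑ i, deg (k := k) x i

theorem size_comp (x y : KPath V) (h : x.src = y.rng) :
    size k (x.comp y h) = size k x + size k y := by
  simp [size, deg_comp, Finset.sum_add_distrib]

theorem deg_eq_zero_of_size_eq_zero {x : KPath V} (h : size k x = 0) : deg (k := k) x = 0 := by
  ext i
  exact (Finset.sum_eq_zero_iff.1 h) i (Finset.mem_univ i)

variable (k) in
/-- A set of paths is saturated if it contains the paths `l α` whenever it contains `l, m, s`
where `l` and `m` have the same degree and source and `m α` is a minimal common extension of `m`
and `s`. -/
def Saturated (E : Set (KPath V)) : Prop :=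
  ∀ ⦃l m s α β : KPath V⦄, l ∈ E → m ∈ E → s ∈ E → deg (k := k) l = deg m → l.src = m.src →
    (α, β) ∈ minExt k m s → ∀ h : l.src = α.rng, l.comp α h ∈ E

variable (k) in
/-- The saturation of a set of paths. -/
inductive Saturation (E : Set (KPath V)) : KPath V → Prop
  | base {x : KPath V} : x ∈ E → Saturation E x
  | step {l m s α β : KPath V} : Saturation E l → Saturation E m → Saturation E s →
      deg (k := k) l = deg m → l.src = m.src → (α, β) ∈ minExt k m s →
      ∀ h : l.src = α.rng, Saturation E (l.comp α h)

variable (k) in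
/-- The saturation of a set of paths, as a set. -/
def saturation (E : Set (KPath V)) : Set (KPath V) := {x | Saturation k E x}

theorem subset_saturation (E : Set (KPath V)) : E ⊆ saturation k E := fun _ h => Saturation.base h

theorem saturated_saturation (E : Set (KPath V)) : Saturated k (saturation k E) :=
  fun _ _ _ _ _ hl hm hs hd hsrc hp h => Saturation.step hl hm hs hd hsrc hp h

theorem saturation_mono {E F : Set (KPath V)} (h : E ⊆ F) : saturation k E ⊆ saturation k F := by
  intro x hx
  induction hx with
  | base hx => exact Saturation.base (h hx)
  | step _ _ _ hd hsrc hp hc hl hm hs => exact Saturation.step hl hm hs hd hsrc hp hc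

/-- In a saturation step `d(l α) = d(m α) = d(m) ∨ d(s)`, so no new upper bound is needed. -/
theorem deg_le_of_mem_saturation {E : Set (KPath V)} {N : Fin k → ℕ}
    (hN : ∀ x ∈ E, deg (k := k) x ≤ N) {x : KPath V} (hx : x ∈ saturation k E) :
    deg (k := k) x ≤ N := by
  induction hx with
  | base hx => exact hN _ hx
  | step _ _ _ hd hsrc hp hc hl hm hs =>
    obtain ⟨h₁, h₂, e, hdeg⟩ := hp
    rw [deg_comp, hd, ← deg_comp _ _ h₁, hdeg]
    exact sup_le hm hs

variable [FinitelyAligned k V]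

/-- Bounded degree alone does not give finiteness, since a vertex may receive infinitely many edges.
The induction is on the total degree: a path of size `n` in the saturation lies in the finite set
`A` built from `E` and smaller elements, or is a smaller element followed by a tail of a path in
`A`. -/
theorem finite_saturation_size_lt {E : Set (KPath V)} (hE : E.Finite) (n : ℕ) :
    {x ∈ saturation k E | size k x < n}.Finite := by
  induction n with
  | zero => simp
  | succ n ih =>
    classical
    set H := {x ∈ saturation k E | size k x < n}
    let A : Set (KPath V) := E ∪ {x | ∃ m ∈ H, ∃ s ∈ H, ∃ p ∈ minExt k m s,
      ∃ h : m.src = p.1.rng, m.comp p.1 h = x}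
    have hA : A.Finite := by
      refine hE.union ?_
      have : (⋃ m ∈ H, ⋃ s ∈ H, (fun p : KPath V × KPath V =>
          if h : m.src = p.1.rng then m.comp p.1 h else m) '' minExt k m s).Finite :=
        ih.biUnion fun m _ => ih.biUnion fun s _ => (FinitelyAligned.finite_minExt m s).image _
      refine this.subset ?_
      rintro x ⟨m, hm, s, hs, p, hp, h, rfl⟩
      simp only [Set.mem_iUnion]
      exact ⟨m, hm, s, hs, p, hp, by simp only [dif_pos h]⟩
    let T := {r : KPath V | ∃ (p : KPath V) (h : p.src = r.rng), p.comp r h ∈ A}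
    have hT : T.Finite := finite_tails k hA
    let B : Set (KPath V) := {x | ∃ l ∈ H, ∃ r ∈ T, ∃ h : l.src = r.rng, l.comp r h = x}
    have hB : B.Finite := by
      have : ((fun p : KPath V × KPath V =>
          if h : p.1.src = p.2.rng then p.1.comp p.2 h else p.1) '' (H ×ˢ T)).Finite :=
        (ih.prod hT).image _
      refine this.subset ?_
      rintro x ⟨l, hl, r, hr, h, rfl⟩
      exact ⟨(l, r), ⟨hl, hr⟩, by simp only [dif_pos h]⟩
    refine (ih.union (hA.union hB)).subset ?_
    rintro x ⟨hx, hxn⟩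
    rcases (Nat.lt_succ_iff.1 hxn).lt_or_eq with hlt | hxn
    · exact .inl ⟨hx, hlt⟩
    refine .inr ?_
    clear * - hx hxn
    -- Inner induction on the construction of `x`, for paths of size exactly `n`. It is needed
    -- because `s` may itself have size `n`.
    induction hx with
    | base hx => exact .inl (.inl hx)
    | @step l m s α β hl hm hs hd hsrc hp h ihl ihm ihs =>
      rcases Nat.eq_zero_or_pos (size k α) with h0 | hpos
      · rw [comp_eq_self h (deg_eq_zero_of_size_eq_zero h0)] at hxn ⊢
        exact ihl hxn
      have hlm : size k l = size k m := by simp only [size, hd]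
      have hp' := hp
      obtain ⟨h₁, h₂, e, hdeg⟩ := hp
      rw [size_comp] at hxn
      have hlH : l ∈ H := ⟨hl, by omega⟩
      have hmH : m ∈ H := ⟨hm, by omega⟩
      have e' := congrArg (size k) e
      rw [size_comp, size_comp] at e'
      dsimp only at e' h₁ h₂
      -- If `β` is trivial, then `m α = s` has size `n` and the inner hypothesis describes `s`.
      -- Otherwise `s` is in `H`, and `m α` is in `A` as a minimal common extension of elements of
      -- `H`.
      rcases Nat.eq_zero_or_pos (size k β) with hb0 | hbpos
      · rw [comp_eq_self (k := k) h₂ (deg_eq_zero_of_size_eq_zero hb0)] at e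
        dsimp only at e
        rcases ihs (by omega) with hsA | ⟨κ, hκ, ω, ⟨q, hq, hqA⟩, hκω, eκ⟩
        · exact .inr ⟨l, hlH, α, ⟨m, h₁, by rw [e]; exact hsA⟩, h, rfl⟩
        -- Here `m α = κ ω` with `κ` in `H`; splitting off the minimal common extension of `m` and
        -- `κ` gives `α = a c` and `ω = b c`.
        · obtain ⟨a, b, c, hab, hac, hbc, rfl, rfl⟩ :=
            exists_minExt_of_comp_eq (k := k) (e.trans eκ.symm)
          have hac' := size_comp (k := k) a c hac
          have hb : size k (b.comp c hbc) = size k b + size k c := size_comp _ _ _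
          -- If `c` is trivial, `m α` is itself a minimal common extension of elements of `H`.
          -- Otherwise `l a` is a smaller saturation step, and `c` is a tail of a path in `A`.
          rcases Nat.eq_zero_or_pos (size k c) with hc0 | hcpos
          · refine .inr ⟨l, hlH, _, ⟨m, h₁, .inr ⟨m, hmH, κ, hκ, _, hab, h₁, ?_⟩⟩, h, rfl⟩
            congr 1
            exact (comp_eq_self (k := k) hac (deg_eq_zero_of_size_eq_zero hc0)).symm
          · refine .inr ⟨l.comp a h, ⟨Saturation.step hl hm hκ.1 hd hsrc hab h, ?_⟩, c,
              ⟨q.comp b hq, hbc, (KPath.comp_assoc q b c hq hbc).symm ▸ hqA⟩, hac,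
              KPath.comp_assoc ..⟩
            have : size k (l.comp a h) = size k l + size k a := size_comp _ _ _
            omega
      · exact .inr ⟨l, hlH, α, ⟨m, h₁, .inr ⟨m, hmH, s, ⟨hs, by omega⟩, _, hp', h₁, rfl⟩⟩, h, rfl⟩

theorem finite_saturation {E : Set (KPath V)} (hE : E.Finite) : (saturation k E).Finite := by
  have hN : ∀ x ∈ E, deg (k := k) x ≤ hE.toFinset.sup (deg (k := k)) := fun x hx =>
    Finset.le_sup (f := deg (k := k)) (hE.mem_toFinset.2 hx)
  refine (finite_saturation_size_lt (k := k) hE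
    (∑ i, hE.toFinset.sup (deg (k := k)) i + 1)).subset fun x hx => ⟨hx, Nat.lt_succ_iff.2 ?_⟩
  exact Finset.sum_le_sum fun i _ => deg_le_of_mem_saturation hN hx i

end KGraph

namespace KGraph

/-! ### Calculus of Cuntz–Krieger families -/

variable {k : ℕ} {V : Type u} [Category.{v} V] [KGraph k V]
  {A : Type*} [NonUnitalCStarAlgebra A] {t : KPath V → A}

section

variable [FinitelyAligned k V]

namespace IsCKFamily

theorem mul_vertex (h : IsCKFamily k t) (x : KPath V) : t x * t (KPath.vertex x.src) = t x :=
  (h.mul x (KPath.vertex x.src) rfl).trans (congrArg t (KPath.comp_vertex x rfl))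

theorem vertex_mul (h : IsCKFamily k t) (x : KPath V) : t (KPath.vertex x.rng) * t x = t x :=
  (h.mul (KPath.vertex x.rng) x rfl).trans (congrArg t (KPath.vertex_comp x rfl))

theorem star_vertex (h : IsCKFamily k t) (a : V) :
    star (t (KPath.vertex a)) = t (KPath.vertex a) :=
  (h.projection a).isSelfAdjoint.star_eq

theorem star_mul_self (h : IsCKFamily k t) (x : KPath V) :
    star (t x) * t x = t (KPath.vertex x.src) := by
  have : (FinitelyAligned.finite_minExt (k := k) x x).toFinset =
      {(KPath.vertex x.src, KPath.vertex x.src)} := by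
    ext p; rw [Set.Finite.mem_toFinset, minExt_self]; simp
  rw [h.star_mul, this, Finset.sum_singleton, h.star_vertex]
  exact (h.projection _).isIdempotentElem.eq

theorem star_mul_eq_zero (h : IsCKFamily k t) {x y : KPath V} (hxy : minExt k x y = ∅) :
    star (t x) * t y = 0 := by
  rw [h.star_mul]
  refine Finset.sum_eq_zero fun p hp => ?_
  rw [Set.Finite.mem_toFinset, hxy] at hp
  exact hp.elim

/-- The product of two elements `t_l t_m^*` and `t_s t_r^*` lies in the span of the elements
`t_{lα} t_{rβ}^*` where `(α, β)` is in `Λ^min(m, s)`. -/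
theorem mul_star_mul_mul_mem (h : IsCKFamily k t) {l m s r : KPath V} (hl : l.src = m.src)
    (hs : s.src = r.src) {S : Submodule ℂ A}
    (H : ∀ (α β : KPath V) (hα : l.src = α.rng) (hβ : r.src = β.rng), (α, β) ∈ minExt k m s →
      t (l.comp α hα) * star (t (r.comp β hβ)) ∈ S) :
    t l * star (t m) * (t s * star (t r)) ∈ S := by
  rw [mul_assoc, ← mul_assoc (star (t m)), h.star_mul, Finset.sum_mul, Finset.mul_sum]
  refine Submodule.sum_mem _ fun ⟨α, β⟩ hp => ?_
  rw [Set.Finite.mem_toFinset] at hp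
  obtain ⟨h₁, h₂, -, -⟩ := id hp
  have := H α β (hl.trans h₁) (hs.symm.trans h₂) hp
  rw [← h.mul, ← h.mul, StarMul.star_mul] at this
  simpa only [mul_assoc] using this

/-- The product is the sum of the range projections of the minimal common extensions, hence
self-adjoint. -/
theorem commute_range (h : IsCKFamily k t) (x y : KPath V) :
    Commute (t x * star (t x)) (t y * star (t y)) := by
  rw [IsSelfAdjoint.commute_iff (.mul_star_self _) (.mul_star_self _), mul_assoc,
    ← mul_assoc (star (t x)), h.star_mul, Finset.sum_mul, Finset.mul_sum]
  refine isSelfAdjoint_sum _ fun ⟨α, β⟩ hp => ?_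
  rw [Set.Finite.mem_toFinset] at hp
  obtain ⟨h₁, h₂, e, -⟩ := id hp
  dsimp only at h₁ h₂ e
  have : t x * (t α * star (t β) * star (t y)) =
      t (x.comp α h₁) * star (t (x.comp α h₁)) := by
    have e' : star (t (x.comp α h₁)) = star (t β) * star (t y) := by
      rw [e, ← h.mul, StarMul.star_mul]
    rw [e', ← h.mul]
    simp only [mul_assoc]
  rw [this]
  exact .mul_star_self _

/-! ### Gap products -/

section gapProd

variable (h : IsCKFamily k t) {a : V} {L : List (KPath V)} (hL : ∀ x ∈ L, x.rng = a)
include h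

theorem gapProd_mul_vertex (a : V) (L : List (KPath V)) :
    gapProd t a L * t (KPath.vertex a) = gapProd t a L := by
  induction L with
  | nil => exact (h.projection a).isIdempotentElem.eq
  | cons x L ih =>
    rw [gapProd, List.foldr_cons, mul_assoc]
    exact congrArg _ ih

include hL

theorem commute_gapProd {x : KPath V} (hx : x.rng = a) :
    Commute (gapProd t a L) (t x * star (t x)) := by
  have hv : Commute (t (KPath.vertex a)) (t x * star (t x)) := by
    subst hx
    have h1 : t (KPath.vertex x.rng) * (t x * star (t x)) = t x * star (t x) := by
      rw [← mul_assoc, h.vertex_mul]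
    have h2 := congrArg star h1
    rw [StarMul.star_mul, h.star_vertex, (IsSelfAdjoint.mul_star_self (t x)).star_eq] at h2
    exact h1.trans h2.symm
  induction L with
  | nil => exact hv
  | cons y L ih =>
    exact (hv.sub_left (h.commute_range y x)).mul_left
      (ih fun z hz => hL z (List.mem_cons_of_mem _ hz))

/-- The range projection of `x` commutes past the later factors and is killed by the factor `t_a -
t_x t_x^*`. -/
theorem gapProd_mul_eq_zero {x : KPath V} (hx : x ∈ L) : gapProd t a L * t x = 0 := by
  induction L with
  | nil => simp at hx
  | cons y L ih =>
    have hL' : ∀ x ∈ L, x.rng = a := fun z hz => hL z (List.mem_cons_of_mem _ hz)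
    change (t (KPath.vertex a) - t y * star (t y)) * gapProd t a L * t x = 0
    rw [mul_assoc]
    rcases List.mem_cons.1 hx with rfl | hx
    · have hxa := hL x List.mem_cons_self
      have e : gapProd t a L * t x = t x * star (t x) * (gapProd t a L * t x) := by
        conv_lhs => rw [← h.partialIsometry x]
        rw [← mul_assoc, ← mul_assoc, mul_assoc (gapProd t a L),
          (h.commute_gapProd hL' hxa).eq, mul_assoc _ _ (t x)]
      rw [e, ← mul_assoc, sub_mul]
      have e1 : t (KPath.vertex a) * (t x * star (t x)) = t x * star (t x) := by
        rw [← hxa, ← mul_assoc, h.vertex_mul]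
      rw [e1, ← mul_assoc (t x * star (t x)), h.partialIsometry, sub_self, zero_mul]
    · rw [ih hL' hx, mul_zero]

omit h in
theorem gapProd_mul_of_star_mul_eq_zero {c : A} (ha : t (KPath.vertex a) * c = c)
    (hc : ∀ x ∈ L, star (t x) * c = 0) : gapProd t a L * c = c := by
  induction L with
  | nil => exact ha
  | cons y L ih =>
    change (t (KPath.vertex a) - t y * star (t y)) * gapProd t a L * c = c
    rw [mul_assoc, ih (fun z hz => hL z (List.mem_cons_of_mem _ hz))
      (fun z hz => hc z (List.mem_cons_of_mem _ hz)), sub_mul, ha, mul_assoc,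
      hc y List.mem_cons_self, mul_zero, sub_zero]

/-- If `y` has no common extension with `x`, then `t_y^* t_x = 0`, so every factor acts trivially.
-/
theorem star_mul_gapProd {y : KPath V} (hy : y.rng = a) (hyL : ∀ x ∈ L, minExt k x y = ∅) :
    star (t y) * gapProd t a L = star (t y) := by
  have hv : star (t y) * t (KPath.vertex a) = star (t y) := by
    subst hy
    simpa only [StarMul.star_mul, h.star_vertex] using congrArg star (h.vertex_mul y)
  induction L with
  | nil => exact hv
  | cons x L ih =>
    change star (t y) * ((t (KPath.vertex a) - t x * star (t x)) * gapProd t a L) = star (t y)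
    have : star (t y) * t x = 0 := by
      simpa only [StarMul.star_mul, star_star, star_zero] using
        congrArg star (h.star_mul_eq_zero (hyL x List.mem_cons_self))
    rw [← mul_assoc, mul_sub, ← mul_assoc (star (t y)) (t x), this, zero_mul, sub_zero, hv]
    exact ih (fun z hz => hL z (List.mem_cons_of_mem _ hz))
      (fun z hz => hyL z (List.mem_cons_of_mem _ hz))

/-- A homomorphism which does not vanish on the vertex projections does not vanish on the
non-zero gap projections. -/
theorem gapProd_eq_zero_of_map_eq_zero {B : Type*} [NonUnitalCStarAlgebra B]
    (φ : A →⋆ₙₐ[ℂ] B) (hφ : ∀ b : V, φ (t (KPath.vertex b)) ≠ 0) (hnd : L.Nodup)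
    (h0 : φ (gapProd t a L) = 0) : gapProd t a L = 0 := by
  -- If some `y` met no path of `L`, then `t_{s(y)} = t_y^* t_y = t_y^* g t_y` for the gap product
  -- `g`, so `φ` would vanish on the vertex `s(y)`.
  refine h.gap a L hnd ⟨hL, fun y hy => ?_⟩
  by_contra! hcon
  have e := h.star_mul_gapProd hL hy hcon
  refine hφ y.src ?_
  rw [← h.star_mul_self, map_mul, ← e, map_mul, h0, mul_zero, zero_mul]

end gapProd

end IsCKFamily

end

/-! ### The algebra of a saturated set and its corners -/

/-- The span of the elements `t_l t_m^*`, where `l` and `m` are paths in `E` with the same degree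
and source. -/
def pairSpan (k : ℕ) [KGraph k V] (t : KPath V → A) (E : Set (KPath V)) : Submodule ℂ A :=
  Submodule.span ℂ {a | ∃ l ∈ E, ∃ m ∈ E, deg (k := k) l = deg m ∧ l.src = m.src ∧
    t l * star (t m) = a}

theorem pairSpan_mono {E F : Set (KPath V)} (hEF : E ⊆ F) : pairSpan k t E ≤ pairSpan k t F :=
  Submodule.span_mono fun _ ⟨l, hl, m, hm, e⟩ => ⟨l, hEF hl, m, hEF hm, e⟩

theorem finiteDimensional_pairSpan {E : Set (KPath V)} (hE : E.Finite) :
    FiniteDimensional ℂ (pairSpan k t E) := by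
  refine FiniteDimensional.span_of_finite ℂ ?_
  refine ((hE.prod hE).image fun p : KPath V × KPath V => t p.1 * star (t p.2)).subset ?_
  rintro _ ⟨l, hl, m, hm, -, -, rfl⟩
  exact ⟨(l, m), ⟨hl, hm⟩, rfl⟩

/-- The *-algebra spanned by the elements `t_l t_m^*`, where `l` and `m` are paths in a saturated
set with the same degree and source. -/
def pairAlgebra [FinitelyAligned k V] (h : IsCKFamily k t) {E : Set (KPath V)}
    (hE : Saturated k E) : NonUnitalStarSubalgebra ℂ A where
  __ := pairSpan k t E
  mul_mem' {a b} ha hb := by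
    change a * b ∈ pairSpan k t E
    induction ha, hb using Submodule.span_induction₂ with
    | mem_mem a b ha hb =>
      obtain ⟨l, hl, m, hm, hd, hs, rfl⟩ := ha
      obtain ⟨l', hl', m', hm', hd', hs', rfl⟩ := hb
      refine h.mul_star_mul_mul_mem hs hs' fun α β hα hβ hp => Submodule.subset_span
        ⟨_, hE hl hm hl' hd hs hp hα, _, hE hm' hl' hm hd'.symm hs'.symm (minExt_symm hp) hβ,
          ?_, (src_eq_of_mem_minExt hp : α.src = β.src), rfl⟩
      obtain ⟨h₁, h₂, e, -⟩ := hp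
      have := congrArg (deg (k := k)) e
      rw [deg_comp, deg_comp] at this
      rw [deg_comp, deg_comp, hd, ← hd', this]
    | zero_left => rw [zero_mul]; exact Submodule.zero_mem _
    | zero_right => rw [mul_zero]; exact Submodule.zero_mem _
    | add_left _ _ _ _ _ _ h₁ h₂ => rw [add_mul]; exact Submodule.add_mem _ h₁ h₂
    | add_right _ _ _ _ _ _ h₁ h₂ => rw [mul_add]; exact Submodule.add_mem _ h₁ h₂
    | smul_left _ _ _ _ _ h₁ => rw [smul_mul_assoc]; exact Submodule.smul_mem _ _ h₁
    | smul_right _ _ _ _ _ h₁ => rw [mul_smul_comm]; exact Submodule.smul_mem _ _ h₁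
  star_mem' {a} ha := by
    change star a ∈ pairSpan k t E
    induction ha using Submodule.span_induction with
    | mem a ha =>
      obtain ⟨l, hl, m, hm, hd, hs, rfl⟩ := ha
      rw [StarMul.star_mul, star_star]
      exact Submodule.subset_span ⟨m, hm, l, hl, hd.symm, hs.symm, rfl⟩
    | zero => rw [star_zero]; exact Submodule.zero_mem _
    | add _ _ _ _ h₁ h₂ => rw [star_add]; exact Submodule.add_mem _ h₁ h₂
    | smul c _ _ h₁ => rw [star_smul]; exact Submodule.smul_mem _ _ h₁

/-- The span of the elements `t_α t_γ^*`, where `l α` and `m γ` are paths in `E` with the same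
degree and source. -/
def cornerSpan (k : ℕ) [KGraph k V] (t : KPath V → A) (E : Set (KPath V)) (l m : KPath V) :
    Submodule ℂ A :=
  Submodule.span ℂ {a | ∃ (α γ : KPath V) (hα : l.src = α.rng) (hγ : m.src = γ.rng),
    l.comp α hα ∈ E ∧ m.comp γ hγ ∈ E ∧ deg (k := k) (l.comp α hα) = deg (m.comp γ hγ) ∧
      α.src = γ.src ∧ t α * star (t γ) = a}

/-- The non-trivial paths which extend `l` to a path in `E`. -/
def extensions (k : ℕ) [KGraph k V] (E : Set (KPath V)) (l : KPath V) : Set (KPath V) :=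
  {α | deg (k := k) α ≠ 0 ∧ ∃ h : l.src = α.rng, l.comp α h ∈ E}

theorem finite_extensions {E : Set (KPath V)} (hE : E.Finite) (l : KPath V) :
    (extensions k E l).Finite :=
  (finite_tails k hE).subset fun _ ⟨_, h, hα⟩ => ⟨l, h, hα⟩

/-- Saturation is applied with `s = m α`, an extension of `m` whose minimal common extension with
`m` is itself. -/
theorem extensions_subset {E : Set (KPath V)} (hE : Saturated k E) {l m : KPath V} (hl : l ∈ E)
    (hm : m ∈ E) (hd : deg (k := k) l = deg m) (hs : l.src = m.src) :
    extensions k E m ⊆ extensions k E l :=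
  fun _ ⟨h0, h, hα⟩ => ⟨h0, hs.trans h, hE hl hm hα hd hs (mem_minExt_of_comp_eq rfl) _⟩

/-- An enumeration of the non-trivial paths which extend `l` to a path in `E`. -/
noncomputable def extensionList (k : ℕ) [KGraph k V] {E : Set (KPath V)} (hE : E.Finite)
    (l : KPath V) : List (KPath V) :=
  (finite_extensions (k := k) hE l).toFinset.toList

variable (k t) in
/-- The gap projection of the set of all non-trivial paths which extend `l` to a path in `E`. -/
noncomputable def gapProj {E : Set (KPath V)} (hE : E.Finite) (l : KPath V) : A :=
  gapProd t l.src (extensionList k hE l)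

theorem mem_extensionList {E : Set (KPath V)} (hE : E.Finite) {l x : KPath V} :
    x ∈ extensionList k hE l ↔ x ∈ extensions k E l := by
  rw [extensionList, Finset.mem_toList, Set.Finite.mem_toFinset]

theorem nodup_extensionList {E : Set (KPath V)} (hE : E.Finite) (l : KPath V) :
    (extensionList k hE l).Nodup :=
  Finset.nodup_toList _

theorem rng_eq_of_mem_extensionList {E : Set (KPath V)} (hE : E.Finite) {l : KPath V} :
    ∀ x ∈ extensionList k hE l, x.rng = l.src :=
  fun _ hx => ((mem_extensionList hE).1 hx).2.1.symm

/-- This makes the left and right gap projections of a compressed matrix unit agree. -/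
theorem gapProj_eq {E : Set (KPath V)} (hE : E.Finite) (hE' : Saturated k E) {l m : KPath V}
    (hl : l ∈ E) (hm : m ∈ E) (hd : deg (k := k) l = deg m) (hs : l.src = m.src) :
    gapProj k t hE l = gapProj k t hE m := by
  have : (finite_extensions (k := k) hE l).toFinset = (finite_extensions (k := k) hE m).toFinset :=
    (Set.Finite.toFinset_inj ..).2 <| (extensions_subset hE' hm hl hd.symm hs.symm).antisymm
      (extensions_subset hE' hl hm hd hs)
  rw [gapProj, gapProj, extensionList, extensionList, hs, this]

variable [FinitelyAligned k V]

namespace IsCKFamily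

/-- Two applications of relation (iii) expand `t_l^* t_x t_y^* t_m`; saturation keeps all the
resulting paths in `E`. -/
theorem star_mul_mul_mem_cornerSpan (h : IsCKFamily k t) {E : Set (KPath V)}
    (hE : Saturated k E) {l m : KPath V} (hl : l ∈ E) (hm : m ∈ E) {a : A}
    (ha : a ∈ pairSpan k t E) : star (t l) * a * t m ∈ cornerSpan k t E l m := by
  induction ha using Submodule.span_induction with
  | zero => simp
  | add _ _ _ _ h₁ h₂ => rw [mul_add, add_mul]; exact Submodule.add_mem _ h₁ h₂
  | smul c _ _ h₁ => rw [mul_smul_comm, smul_mul_assoc]; exact Submodule.smul_mem _ _ h₁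
  | mem a ha =>
    obtain ⟨x, hx, y, hy, hd, hs, rfl⟩ := ha
    -- Inserting source vertices puts both outer factors in the form `t t^*` required by
    -- `mul_star_mul_mul_mem`.
    have e1 : star (t l) = t (KPath.vertex l.src) * star (t l) := by
      rw [← h.star_vertex, ← StarMul.star_mul, h.mul_vertex]
    have e2 : t m = t m * star (t (KPath.vertex m.src)) := by rw [h.star_vertex, h.mul_vertex]
    rw [e1, e2]
    have step : t (KPath.vertex l.src) * star (t l) * (t x * star (t y)) ∈
        Submodule.span ℂ {b | ∃ (α ρ : KPath V) (hα : l.src = α.rng), l.comp α hα ∈ E ∧ ρ ∈ E ∧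
          deg (k := k) (l.comp α hα) = deg ρ ∧ α.src = ρ.src ∧ t α * star (t ρ) = b} := by
      refine h.mul_star_mul_mul_mem (l := KPath.vertex l.src) (m := l) rfl hs fun α β hα hβ hp => ?_
      refine Submodule.subset_span
        ⟨α, y.comp β hβ, hα, hE hl hl hx rfl rfl hp hα,
          hE hy hx hl hd.symm hs.symm (minExt_symm hp) hβ, ?_,
          (src_eq_of_mem_minExt hp : α.src = β.src), ?_⟩
      · obtain ⟨h₁, h₂, e, -⟩ := hp
        have := congrArg (deg (k := k)) e
        rw [deg_comp, deg_comp] at this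
        exact (deg_comp l α hα).trans (by rw [this, deg_comp, hd])
      · exact congrArg (t · * star (t (y.comp β hβ))) (KPath.vertex_comp α hα).symm
    generalize t (KPath.vertex l.src) * star (t l) * (t x * star (t y)) = b at step
    induction step using Submodule.span_induction with
    | zero => simp
    | add _ _ _ _ h₁ h₂ => rw [add_mul]; exact Submodule.add_mem _ h₁ h₂
    | smul c _ _ h₁ => rw [smul_mul_assoc]; exact Submodule.smul_mem _ _ h₁
    | mem b hb =>
      obtain ⟨α, ρ, hα, hlα, hρ, hdα, hsα, rfl⟩ := hb
      refine h.mul_star_mul_mul_mem (s := m) (r := KPath.vertex m.src) hsα rfl fun β γ hβ hγ hp => ?_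
      refine Submodule.subset_span
        ⟨α.comp β hβ, γ, hα, hγ, ?_, hE hm hm hρ rfl rfl (minExt_symm hp) hγ, ?_,
          (src_eq_of_mem_minExt hp : β.src = γ.src), ?_⟩
      · have := hE hlα hρ hm hdα hsα hp hβ
        rwa [KPath.comp_assoc] at this
      · obtain ⟨h₁, h₂, e, -⟩ := hp
        have e' := congrArg (deg (k := k)) e
        rw [deg_comp] at e'
        rw [← e', ← hdα, ← KPath.comp_assoc, deg_comp (l.comp α hα) β hβ]
      · exact congrArg (fun x => t (α.comp β hβ) * star (t x)) (KPath.vertex_comp γ hγ).symm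

/-- A gap projection kills `t_α` whenever `α` is a proper extension, so only terms with both `α` and
`γ` trivial survive. Those have `d(l) = d(m)` and `s(l) = s(m)`, and the two gap projections
coincide. -/
theorem gapProj_mul_mem_span (h : IsCKFamily k t) {E : Set (KPath V)} (hE : E.Finite)
    (hE' : Saturated k E) {l m : KPath V} (hl : l ∈ E) (hm : m ∈ E) {c : A}
    (hc : c ∈ cornerSpan k t E l m) : gapProj k t hE l * c * star (gapProj k t hE m) ∈
      Submodule.span ℂ {gapProj k t hE l * star (gapProj k t hE l)} := by
  induction hc using Submodule.span_induction with
  | zero => simp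
  | add _ _ _ _ h₁ h₂ => rw [mul_add, add_mul]; exact Submodule.add_mem _ h₁ h₂
  | smul c _ _ h₁ => rw [mul_smul_comm, smul_mul_assoc]; exact Submodule.smul_mem _ _ h₁
  | mem c hc =>
    obtain ⟨α, γ, hα, hγ, hlα, hmγ, hd, hs, rfl⟩ := hc
    have e : gapProj k t hE l * (t α * star (t γ)) * star (gapProj k t hE m) =
        gapProj k t hE l * t α * star (gapProj k t hE m * t γ) := by
      simp only [StarMul.star_mul, mul_assoc]
    rw [e]
    by_cases hα0 : deg (k := k) α = 0
    · by_cases hγ0 : deg (k := k) γ = 0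
      · have eα := eq_vertex_of_deg_eq_zero hα0
        have eγ := eq_vertex_of_deg_eq_zero hγ0
        have hlm : l.src = m.src := by
          rw [hα, hγ]
          have h1 := congrArg KPath.src eα
          have h2 := congrArg KPath.src eγ
          exact h1.symm.trans (hs.trans h2)
        have g1 : gapProj k t hE l * t α = gapProj k t hE l := by
          rw [eα, ← hα]; exact h.gapProd_mul_vertex _ _
        have g2 : gapProj k t hE m * t γ = gapProj k t hE m := by
          rw [eγ, ← hγ]; exact h.gapProd_mul_vertex _ _
        rw [deg_comp, deg_comp, hα0, hγ0, add_zero, add_zero] at hd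
        rw [g1, g2, ← gapProj_eq hE hE' hl hm hd hlm]
        exact Submodule.mem_span_singleton_self _
      · rw [gapProj, gapProj, h.gapProd_mul_eq_zero 
          (rng_eq_of_mem_extensionList hE)
          ((mem_extensionList hE).2 ⟨hγ0, hγ, hmγ⟩), star_zero, mul_zero]
        exact Submodule.zero_mem _
    · rw [gapProj, h.gapProd_mul_eq_zero (rng_eq_of_mem_extensionList hE)
        ((mem_extensionList hE).2 ⟨hα0, hα, hlα⟩), zero_mul]
      exact Submodule.zero_mem _

/-! ### Injectivity on the algebra of a finite saturated set -/

theorem eq_zero_of_forall_star_mul_mul_eq_zero {E : Set (KPath V)} {a : A}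
    (h : IsCKFamily k t) (hE : Saturated k E) (ha : a ∈ pairSpan k t E)
    (h0 : ∀ l ∈ E, ∀ m ∈ E, star (t l) * a * t m = 0) : a = 0 := by
  have h1 : ∀ b ∈ pairSpan k t E, ∀ m ∈ E, b * a * t m = 0 := by
    intro b hb m hm
    induction hb using Submodule.span_induction with
    | zero => simp
    | add _ _ _ _ h₁ h₂ => rw [add_mul, add_mul, h₁, h₂, add_zero]
    | smul c _ _ h₁ => rw [smul_mul_assoc, smul_mul_assoc, h₁, smul_zero]
    | mem b hb =>
      obtain ⟨x, hx, y, hy, -, -, rfl⟩ := hb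
      rw [mul_assoc (t x), mul_assoc (t x), h0 y hy m hm, mul_zero]
  have h2 : ∀ b ∈ pairSpan k t E, ∀ c ∈ pairSpan k t E, b * a * c = 0 := by
    intro b hb c hc
    induction hc using Submodule.span_induction with
    | zero => simp
    | add _ _ _ _ h₁ h₂ => rw [mul_add, h₁, h₂, add_zero]
    | smul c _ _ h₁ => rw [mul_smul_comm, h₁, smul_zero]
    | mem c hc =>
      obtain ⟨x, hx, y, hy, -, -, rfl⟩ := hc
      rw [← mul_assoc, h1 b hb x hx, zero_mul]
  have ha' : star a ∈ pairSpan k t E := (pairAlgebra h hE).star_mem' ha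
  have h3 := h2 _ ha' _ ha'
  -- The hypothesis gives `b a c = 0` for all `b, c` in the algebra; `b = c = a^*` yields `(a^* a)^2
  -- = 0`, and the C*-identity applied twice finishes.
  have h4 : star (star a * a) * (star a * a) = 0 := by
    rw [StarMul.star_mul, star_star, ← mul_assoc, h3, zero_mul]
  exact (CStarRing.star_mul_self_eq_zero_iff _).1 ((CStarRing.star_mul_self_eq_zero_iff _).1 h4)

/-- A homomorphism which does not vanish on the vertex projections is injective on the *-algebra
of a finite saturated set. -/
theorem eq_zero_of_map_eq_zero (h : IsCKFamily k t) {B : Type*} [NonUnitalCStarAlgebra B]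
    (φ : A →⋆ₙₐ[ℂ] B) (hφ : ∀ b : V, φ (t (KPath.vertex b)) ≠ 0) {E : Set (KPath V)}
    (hE : E.Finite) (hE' : Saturated k E) {a : A} (ha : a ∈ pairSpan k t E) (h0 : φ a = 0) :
    a = 0 := by
  by_contra hne
  -- A nonzero corner of maximal total degree exists because `E` is finite and not all corners
  -- vanish.
  have hex : ∃ p ∈ {p : KPath V × KPath V | p ∈ E ×ˢ E ∧ star (t p.1) * a * t p.2 ≠ 0},
      ∀ q ∈ {p : KPath V × KPath V | p ∈ E ×ˢ E ∧ star (t p.1) * a * t p.2 ≠ 0},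
        size k q.1 + size k q.2 ≤ size k p.1 + size k p.2 := by
    refine Set.exists_max_image _ _ ((hE.prod hE).subset fun p hp => hp.1) ?_
    by_contra hcon
    rw [Set.not_nonempty_iff_eq_empty] at hcon
    refine hne (h.eq_zero_of_forall_star_mul_mul_eq_zero hE' ha fun l hl m hm => ?_)
    by_contra hlm
    exact (Set.eq_empty_iff_forall_notMem.1 hcon) (l, m) ⟨⟨hl, hm⟩, hlm⟩
  obtain ⟨⟨l, m⟩, ⟨⟨hl, hm⟩, hlm⟩, hmax⟩ := hex
  dsimp only at hl hm hlm hmax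
  set c := star (t l) * a * t m with hc
  have hpos : ∀ {x : KPath V}, deg (k := k) x ≠ 0 → 0 < size k x := fun hx =>
    Nat.pos_of_ne_zero fun h0 => hx (deg_eq_zero_of_size_eq_zero h0)
  -- For a proper extension `l x` in `E`, `t_x^* c` is the corner at `(l x, m)`, which vanishes by
  -- maximality.
  have c1 : gapProj k t hE l * c = c := by
    refine gapProd_mul_of_star_mul_eq_zero (rng_eq_of_mem_extensionList hE) ?_ fun x hx => ?_
    · have : t (KPath.vertex l.src) * star (t l) = star (t l) := by
        rw [← h.star_vertex, ← StarMul.star_mul, h.mul_vertex]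
      rw [hc, ← mul_assoc, ← mul_assoc, this]
    · obtain ⟨hx0, hlx, hxE⟩ := (mem_extensionList hE).1 hx
      by_contra hcon
      have e : star (t x) * c = star (t (l.comp x hlx)) * a * t m := by
        rw [← h.mul, StarMul.star_mul]; simp only [hc, mul_assoc]
      have := hmax (l.comp x hlx, m) ⟨⟨hxE, hm⟩, by rwa [← e]⟩
      dsimp only at this
      rw [size_comp] at this
      have := hpos hx0
      omega
  have c2 : c * star (gapProj k t hE m) = c := by
    have : gapProj k t hE m * star c = star c := by
      refine gapProd_mul_of_star_mul_eq_zero (rng_eq_of_mem_extensionList hE) ?_ fun x hx => ?_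
      · rw [hc, StarMul.star_mul, ← mul_assoc, ← h.star_vertex, ← StarMul.star_mul, h.mul_vertex]
      · obtain ⟨hx0, hmx, hxE⟩ := (mem_extensionList hE).1 hx
        by_contra hcon
        have e : star (star (t x) * star c) = star (t l) * a * t (m.comp x hmx) := by
          rw [← h.mul, StarMul.star_mul, star_star, star_star]; simp only [hc, mul_assoc]
        have := hmax (l, m.comp x hmx) ⟨⟨hl, hxE⟩, by rw [← e]; exact star_ne_zero.2 hcon⟩
        dsimp only at this
        rw [size_comp] at this
        have := hpos hx0
        omega
    simpa only [StarMul.star_mul, star_star] using congrArg star this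
  have hspan := h.gapProj_mul_mem_span hE hE' hl hm (h.star_mul_mul_mem_cornerSpan hE' hl hm ha)
  rw [← hc, c1, c2] at hspan
  -- Now `c = x g g^*` for the gap projection `g` at `l`, with `x ≠ 0` since `c ≠ 0`; so `φ(c) = 0`
  -- gives `φ(g) = 0`.
  obtain ⟨x, hx⟩ := Submodule.mem_span_singleton.1 hspan
  have hφc : φ c = 0 := by rw [hc, map_mul, map_mul, h0, mul_zero, zero_mul]
  have hx0 : x ≠ 0 := by rintro rfl; exact hlm (by rw [← hx, zero_smul])
  rw [← hx, map_smul, smul_eq_zero_iff_right hx0, map_mul, map_star φ,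
    CStarRing.mul_star_self_eq_zero_iff] at hφc
  have := h.gapProd_eq_zero_of_map_eq_zero (rng_eq_of_mem_extensionList hE) φ hφ
    (nodup_extensionList hE l) hφc
  refine hlm ?_
  rw [← hx, gapProj, this, zero_mul, smul_zero]

end IsCKFamily

end KGraph

namespace KGraph

/-! ### Averaging over the gauge action -/

variable {k : ℕ} {V : Type u} [Category.{v} V] [KGraph k V] [FinitelyAligned k V]

/-- The span of the elements `t_l t_m^*`, where `l` and `m` are paths with the same source, is a
*-algebra. -/
def spanAlgebra {A : Type*} [NonUnitalCStarAlgebra A] {t : KPath V → A} (h : IsCKFamily k t) :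
    NonUnitalStarSubalgebra ℂ A where
  __ := Submodule.span ℂ {a | ∃ l m : KPath V, l.src = m.src ∧ t l * star (t m) = a}
  mul_mem' {a b} ha hb := by
    change a * b ∈ Submodule.span ℂ {a | ∃ l m : KPath V, l.src = m.src ∧ t l * star (t m) = a}
    induction ha, hb using Submodule.span_induction₂ with
    | mem_mem a b ha hb =>
      obtain ⟨l, m, hs, rfl⟩ := ha
      obtain ⟨l', m', hs', rfl⟩ := hb
      exact h.mul_star_mul_mul_mem hs hs' fun α β hα hβ hp => Submodule.subset_span
        ⟨l.comp α hα, m'.comp β hβ, (src_eq_of_mem_minExt hp : α.src = β.src), rfl⟩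
    | zero_left => rw [zero_mul]; exact Submodule.zero_mem _
    | zero_right => rw [mul_zero]; exact Submodule.zero_mem _
    | add_left _ _ _ _ _ _ h₁ h₂ => rw [add_mul]; exact Submodule.add_mem _ h₁ h₂
    | add_right _ _ _ _ _ _ h₁ h₂ => rw [mul_add]; exact Submodule.add_mem _ h₁ h₂
    | smul_left _ _ _ _ _ h₁ => rw [smul_mul_assoc]; exact Submodule.smul_mem _ _ h₁
    | smul_right _ _ _ _ _ h₁ => rw [mul_smul_comm]; exact Submodule.smul_mem _ _ h₁
  star_mem' {a} ha := by
    change star a ∈ Submodule.span ℂ {a | ∃ l m : KPath V, l.src = m.src ∧ t l * star (t m) = a}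
    induction ha using Submodule.span_induction with
    | mem a ha =>
      obtain ⟨l, m, hs, rfl⟩ := ha
      rw [StarMul.star_mul, star_star]
      exact Submodule.subset_span ⟨m, l, hs.symm, rfl⟩
    | zero => rw [star_zero]; exact Submodule.zero_mem _
    | add _ _ _ _ h₁ h₂ => rw [star_add]; exact Submodule.add_mem _ h₁ h₂
    | smul c _ _ h₁ => rw [star_smul]; exact Submodule.smul_mem _ _ h₁

theorem mem_spanAlgebra {A : Type*} [NonUnitalCStarAlgebra A] {t : KPath V → A}
    (h : IsCKFamily k t) {a : A} : a ∈ spanAlgebra h ↔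
      a ∈ Submodule.span ℂ {a | ∃ l m : KPath V, l.src = m.src ∧ t l * star (t m) = a} := Iff.rfl

theorem mem_spanAlgebra_of_path {A : Type*} [NonUnitalCStarAlgebra A] {t : KPath V → A}
    (h : IsCKFamily k t) (x : KPath V) : t x ∈ spanAlgebra h := by
  refine Submodule.subset_span ⟨x, KPath.vertex x.src, rfl, ?_⟩
  rw [h.star_vertex, h.mul_vertex]

namespace CStar

theorem dense_spanAlgebra :
    Dense (spanAlgebra (isCKFamily_gen (k := k) (V := V)) : Set (CStar k V)) := by
  intro a
  rw [closure_subtype]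
  refine closure_mono ?_ a.2
  have hle : NonUnitalStarAlgebra.adjoin ℂ (Set.range (prodFam (V := V) k)) ≤
      (spanAlgebra (isCKFamily_gen (k := k) (V := V))).map
        (NonUnitalStarSubalgebraClass.subtype (cstarSubalgebra k V)) := by
    refine NonUnitalStarAlgebra.adjoin_le ?_
    rintro _ ⟨x, rfl⟩
    exact ⟨gen k x, mem_spanAlgebra_of_path isCKFamily_gen x, rfl⟩
  exact hle

omit [FinitelyAligned k V] in
theorem gaugeCoeff_mul (z w : Fin k → Circle) (x : KPath V) :
    gaugeCoeff k (z * w) x = gaugeCoeff k z x * gaugeCoeff k w x := by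
  simp [gaugeCoeff, mul_pow, Finset.prod_mul_distrib]

theorem gaugeAction_gen_mul_star (z : Fin k → Circle) (l m : KPath V) :
    gaugeAction k V z (gen k l * star (gen k m)) =
      ((gaugeCoeff k z l / gaugeCoeff k z m : Circle) : ℂ) • (gen k l * star (gen k m)) := by
  rw [map_mul, map_star, gaugeAction_gen, gaugeAction_gen, star_smul, smul_mul_smul_comm,
    div_eq_mul_inv, Circle.coe_mul, Circle.coe_inv_eq_conj, starRingEnd_apply]

theorem pairSpan_le_core {E : Set (KPath V)} {a : CStar k V}
    (ha : a ∈ pairSpan k (gen k : KPath V → CStar k V) E) : a ∈ core k V := by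
  induction ha using Submodule.span_induction with
  | zero => exact zero_mem _
  | add _ _ _ _ h₁ h₂ => exact add_mem h₁ h₂
  | smul c _ _ h₁ => exact SMulMemClass.smul_mem c h₁
  | mem a ha =>
    obtain ⟨l, -, m, -, hd, -, rfl⟩ := ha
    intro z
    have : gaugeCoeff k z l = gaugeCoeff k z m := by simp only [gaugeCoeff, hd]
    rw [gaugeAction_gen_mul_star, this, div_self', Circle.coe_one, one_smul]

/-- The average of the gauge automorphisms over the `k`-tuples of `(N+1)`-st roots of unity. -/
noncomputable def rootAverage (k : ℕ) (V : Type u) [Category.{v} V] [KGraph k V]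
    [FinitelyAligned k V] (N : ℕ) (a : CStar k V) : CStar k V :=
  ((Fintype.card (Fin k → ZMod (N + 1)) : ℂ)⁻¹) •
    ∑ j : Fin k → ZMod (N + 1), gaugeAction k V (fun i => ZMod.toCircle (j i)) a

theorem rootAverage_add (N : ℕ) (a b : CStar k V) :
    rootAverage k V N (a + b) = rootAverage k V N a + rootAverage k V N b := by
  simp only [rootAverage, map_add, Finset.sum_add_distrib, smul_add]

theorem rootAverage_sub (N : ℕ) (a b : CStar k V) :
    rootAverage k V N (a - b) = rootAverage k V N a - rootAverage k V N b := by
  simp only [rootAverage, map_sub, Finset.sum_sub_distrib, smul_sub]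

theorem rootAverage_smul (N : ℕ) (c : ℂ) (a : CStar k V) :
    rootAverage k V N (c • a) = c • rootAverage k V N a := by
  simp only [rootAverage, map_smul, ← Finset.smul_sum]
  rw [smul_comm]

theorem norm_rootAverage_le (N : ℕ) (a : CStar k V) : ‖rootAverage k V N a‖ ≤ ‖a‖ := by
  have hsum : ‖∑ j : Fin k → ZMod (N + 1), gaugeAction k V (fun i => ZMod.toCircle (j i)) a‖ ≤
      Fintype.card (Fin k → ZMod (N + 1)) * ‖a‖ := by
    refine (norm_sum_le _ _).trans_eq ?_
    rw [Finset.sum_congr rfl fun j _ => NonUnitalStarAlgHom.norm_map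
      (gaugeAction k V fun i => ZMod.toCircle (j i)) (EquivLike.injective _) a]
    simp
  have hpos : (0 : ℝ) < Fintype.card (Fin k → ZMod (N + 1)) := by
    exact_mod_cast Fintype.card_pos
  rw [rootAverage, norm_smul, norm_inv, Complex.norm_natCast, inv_mul_le_iff₀ hpos]
  exact hsum

theorem rootAverage_of_mem_core (N : ℕ) {a : CStar k V} (ha : a ∈ core k V) :
    rootAverage k V N a = a := by
  have : (Fintype.card (Fin k → ZMod (N + 1)) : ℂ) ≠ 0 := by
    exact_mod_cast Fintype.card_ne_zero
  rw [rootAverage, Finset.sum_congr rfl fun j _ => ha _, Finset.sum_const, Finset.card_univ,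
    ← Nat.cast_smul_eq_nsmul ℂ, smul_smul, inv_mul_cancel₀ this, one_smul]

/-- The average is a multiple of the sum of a character of `(ℤ/(N+1))^k`, which is nontrivial in
coordinate `i`. -/
theorem rootAverage_gen_mul_star_eq_zero {N : ℕ} {l m : KPath V} {i : Fin k}
    (hl : deg (k := k) l i ≤ N) (hm : deg (k := k) m i ≤ N)
    (hlm : deg (k := k) l i ≠ deg (k := k) m i) :
    rootAverage k V N (gen k l * star (gen k m)) = 0 := by
  simp only [rootAverage, gaugeAction_gen_mul_star, ← Finset.sum_smul]
  let χ (j : Fin k → ZMod (N + 1)) : Circle :=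
    gaugeCoeff k (fun i => ZMod.toCircle (j i)) l / gaugeCoeff k (fun i => ZMod.toCircle (j i)) m
  have hadd (j j' : Fin k → ZMod (N + 1)) : χ (j + j') = χ j * χ j' := by
    have : (fun i => ZMod.toCircle ((j + j') i)) =
        (fun i => ZMod.toCircle (j i)) * fun i => ZMod.toCircle (j' i) := by
      ext i; simp [AddChar.map_add_eq_mul]
    simp only [χ, this, gaugeCoeff_mul]
    exact mul_div_mul_comm _ _ _ _
  have hsingle (x : KPath V) :
      gaugeCoeff k (fun i' => ZMod.toCircle ((Pi.single i 1 : Fin k → ZMod (N + 1)) i')) x =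
        ZMod.toCircle ((deg (k := k) x i : ℕ) : ZMod (N + 1)) := by
    rw [gaugeCoeff, Finset.prod_eq_single i]
    · rw [Pi.single_eq_same, ← AddChar.map_nsmul_eq_pow, nsmul_one]
    · intro b _ hb
      rw [Pi.single_eq_of_ne hb, AddChar.map_zero_eq_one, one_pow]
    · simp
  -- Both degrees are at most `N`, so they remain distinct modulo `N + 1`.
  have hχ : (χ (Pi.single i 1) : ℂ) ≠ 1 := by
    intro h1
    rw [Circle.coe_eq_one, div_eq_one, hsingle, hsingle] at h1
    have h2 := congrArg ZMod.val (ZMod.injective_toCircle h1)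
    rw [ZMod.val_cast_of_lt (by omega), ZMod.val_cast_of_lt (by omega)] at h2
    exact hlm h2
  have hsum : ∑ j, (χ j : ℂ) = 0 := by
    -- Translation by the `i`-th unit vector permutes the index set and multiplies the sum by a
    -- number other than `1`.
    have e : ∑ j, (χ j : ℂ) = (∑ j, (χ j : ℂ)) * χ (Pi.single i 1) := by
      refine (Equiv.sum_comp (Equiv.addRight (Pi.single i 1)) fun j => (χ j : ℂ)).symm.trans ?_
      simp only [Equiv.coe_addRight, hadd, Circle.coe_mul, Finset.sum_mul]
    by_contra hne
    exact hχ (mul_left_cancel₀ hne (by rw [← e, mul_one]))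
  exact (congrArg _ ((congrArg (· • (gen k l * star (gen k m))) hsum).trans (zero_smul ℂ _))).trans
    (smul_zero _)

theorem exists_rootAverage_mem_pairSpan {a : CStar k V}
    (ha : a ∈ spanAlgebra (isCKFamily_gen (k := k) (V := V))) :
    ∃ N₀, ∀ N ≥ N₀, rootAverage k V N a ∈ pairSpan k (gen k : KPath V → CStar k V) Set.univ := by
  rw [mem_spanAlgebra] at ha
  induction ha using Submodule.span_induction with
  | zero => exact ⟨0, fun N _ => by simp [rootAverage]⟩
  | add _ _ _ _ h₁ h₂ =>
    obtain ⟨N₁, h₁⟩ := h₁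
    obtain ⟨N₂, h₂⟩ := h₂
    refine ⟨max N₁ N₂, fun N hN => ?_⟩
    rw [rootAverage_add]
    exact add_mem (h₁ N (le_of_max_le_left hN)) (h₂ N (le_of_max_le_right hN))
  | smul c _ _ h₁ =>
    obtain ⟨N₁, h₁⟩ := h₁
    refine ⟨N₁, fun N hN => ?_⟩
    rw [rootAverage_smul]
    exact Submodule.smul_mem _ _ (h₁ N hN)
  | mem a ha =>
    obtain ⟨l, m, hs, rfl⟩ := ha
    -- This bound dominates every coordinate of both degrees.
    refine ⟨size k l + size k m, fun N hN => ?_⟩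
    by_cases hd : deg (k := k) l = deg m
    · have hp : gen k l * star (gen k m) ∈ pairSpan k (gen k : KPath V → CStar k V) Set.univ :=
        Submodule.subset_span ⟨l, trivial, m, trivial, hd, hs, rfl⟩
      rwa [rootAverage_of_mem_core N (pairSpan_le_core hp)]
    · obtain ⟨i, hi⟩ := Function.ne_iff.1 hd
      have hle (x : KPath V) : deg (k := k) x i ≤ size k x :=
        Finset.single_le_sum (f := deg (k := k) x) (fun _ _ => Nat.zero_le _) (Finset.mem_univ i)
      have h1 := hle l
      have h2 := hle m
      rw [rootAverage_gen_mul_star_eq_zero (i := i) (by omega) (by omega) hi]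
      exact zero_mem _

/-- An element of the core equals its averages, so averaging an approximant from the dense *-algebra
keeps the error below `ε`. -/
theorem core_subset_closure : (core k V : Set (CStar k V)) ⊆
    closure (pairSpan k (gen k : KPath V → CStar k V) Set.univ : Set (CStar k V)) := by
  intro a ha
  rw [Metric.mem_closure_iff]
  intro ε hε
  obtain ⟨x, hx, hax⟩ := Metric.mem_closure_iff.1 (dense_spanAlgebra a) ε hε
  obtain ⟨N, hN⟩ := exists_rootAverage_mem_pairSpan hx
  refine ⟨_, hN N le_rfl, ?_⟩
  rw [dist_eq_norm] at hax ⊢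
  rw [← rootAverage_of_mem_core N ha, ← rootAverage_sub]
  exact (norm_rootAverage_le N _).trans_lt hax

end CStar

/-! ### Exhaustion by finite saturated sets and passage to the core -/

theorem exists_saturated_exhaustion (k : ℕ) (V : Type u) [Category.{v} V] [KGraph k V]
    [FinitelyAligned k V] : ∃ E : ℕ → Set (KPath V), Monotone E ∧ (∀ n, (E n).Finite) ∧
      (∀ n, Saturated k (E n)) ∧ ∀ x, ∃ n, x ∈ E n := by
  have : Countable (KPath V) := countable_path k
  obtain ⟨f, hf⟩ := exists_injective_nat (KPath V)
  refine ⟨fun n => saturation k (f ⁻¹' Set.Iic n), fun m n hmn => saturation_mono fun x hx =>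
    le_trans (α := ℕ) hx hmn, fun n => finite_saturation ((Set.finite_Iic n).preimage hf.injOn),
    fun n => saturated_saturation _, fun x => ⟨f x, subset_saturation _ (le_refl (f x))⟩⟩

omit [FinitelyAligned k V] in
theorem exists_mem_pairSpan {A : Type*} [NonUnitalCStarAlgebra A] {t : KPath V → A}
    {E : ℕ → Set (KPath V)} (hE : Monotone E) (hE' : ∀ x, ∃ n, x ∈ E n) {a : A}
    (ha : a ∈ pairSpan k t Set.univ) : ∃ n, a ∈ pairSpan k t (E n) := by
  induction ha using Submodule.span_induction with
  | zero => exact ⟨0, zero_mem _⟩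
  | add _ _ _ _ h₁ h₂ =>
    obtain ⟨m, h₁⟩ := h₁
    obtain ⟨n, h₂⟩ := h₂
    exact ⟨max m n, add_mem (pairSpan_mono (hE (le_max_left m n)) h₁)
      (pairSpan_mono (hE (le_max_right m n)) h₂)⟩
  | smul c _ _ h₁ =>
    obtain ⟨m, h₁⟩ := h₁
    exact ⟨m, Submodule.smul_mem _ _ h₁⟩
  | mem a ha =>
    obtain ⟨l, -, m, -, hd, hs, rfl⟩ := ha
    obtain ⟨i, hi⟩ := hE' l
    obtain ⟨j, hj⟩ := hE' m
    exact ⟨max i j, Submodule.subset_span ⟨l, hE (le_max_left i j) hi, m,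
      hE (le_max_right i j) hj, hd, hs, rfl⟩⟩

/-- A homomorphism which does not vanish on the vertex projections is isometric on the *-algebra
of a finite saturated set. -/
theorem IsCKFamily.norm_map_eq {A B : Type*} [NonUnitalCStarAlgebra A] [NonUnitalCStarAlgebra B]
    {t : KPath V → A} (h : IsCKFamily k t) (φ : A →⋆ₙₐ[ℂ] B)
    (hφ : ∀ b : V, φ (t (KPath.vertex b)) ≠ 0) {E : Set (KPath V)} (hE : E.Finite)
    (hE' : Saturated k E) {a : A} (ha : a ∈ pairSpan k t E) : ‖φ a‖ = ‖a‖ := by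
  have := finiteDimensional_pairSpan (k := k) (t := t) hE
  -- Finite-dimensionality makes this a C*-algebra, where injective homomorphisms are isometric.
  have : IsClosed (pairAlgebra h hE' : Set A) :=
    Submodule.closed_of_finiteDimensional (pairSpan k t E)
  let ψ : pairAlgebra h hE' →⋆ₙₐ[ℂ] B :=
    φ.comp (NonUnitalStarSubalgebraClass.subtype (pairAlgebra h hE'))
  have hψ : Function.Injective ψ := (injective_iff_map_eq_zero ψ).2 fun x hx =>
    Subtype.ext (h.eq_zero_of_map_eq_zero φ hφ hE hE' x.2 hx)
  exact NonUnitalStarAlgHom.norm_map ψ hψ ⟨a, ha⟩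

theorem CStar.isAF_core : IsAF (core k V) := by
  obtain ⟨E, hmono, hfin, hsat, hcov⟩ := exists_saturated_exhaustion k V
  refine ⟨fun n => (pairAlgebra (isCKFamily_gen (k := k) (V := V)) (hsat n)).comap
    (NonUnitalStarSubalgebraClass.subtype (core k V)), fun m n hmn a ha =>
      pairSpan_mono (hmono hmn) ha, fun n => ?_, fun a => ?_⟩
  · have := finiteDimensional_pairSpan (k := k) (t := (gen k : KPath V → CStar k V)) (hfin n)
    let f : (pairAlgebra (isCKFamily_gen (k := k) (V := V)) (hsat n)).comap
        (NonUnitalStarSubalgebraClass.subtype (core k V)) →ₗ[ℂ]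
        pairSpan k (gen k : KPath V → CStar k V) (E n) :=
      { toFun x := ⟨x.1.1, x.2⟩
        map_add' _ _ := rfl
        map_smul' _ _ := rfl }
    exact FiniteDimensional.of_injective f fun x y hxy =>
      Subtype.ext (Subtype.ext (Subtype.ext_iff.1 hxy :))
  · rw [closure_subtype]
    refine closure_mono (fun b hb => ?_) (core_subset_closure a.2)
    obtain ⟨n, hn⟩ := exists_mem_pairSpan hmono hcov hb
    exact ⟨⟨b, pairSpan_le_core hb⟩, Set.mem_iUnion.2 ⟨n, hn⟩, rfl⟩

/-- The norm equality is a closed condition and extends from the dense union to the core; bare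
injectivity would not. -/
theorem CStar.norm_map_of_mem_core {B : Type*} [NonUnitalCStarAlgebra B]
    (φ : CStar k V →⋆ₙₐ[ℂ] B) (hφ : ∀ b : V, φ (gen k (KPath.vertex b)) ≠ 0) {a : CStar k V}
    (ha : a ∈ core k V) : ‖φ a‖ = ‖a‖ := by
  obtain ⟨E, hmono, hfin, hsat, hcov⟩ := exists_saturated_exhaustion k V
  have hcont : Continuous φ :=
    NonUnitalStarAlgHom.instContinuousLinearMapClassComplex.map_continuous φ
  have hclosed : IsClosed {x : CStar k V | ‖φ x‖ = ‖x‖} :=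
    isClosed_eq hcont.norm continuous_norm
  refine closure_minimal (fun x hx => ?_) hclosed (core_subset_closure ha)
  obtain ⟨n, hn⟩ := exists_mem_pairSpan hmono hcov hx
  exact isCKFamily_gen.norm_map_eq φ hφ (hfin n) (hsat n) hn

end KGraph

theorem theorem3p1 (k : ℕ) (V : Type u) [Category.{v} V] [KGraph k V]
    [KGraph.FinitelyAligned k V] :
    IsAF (KGraph.CStar.core k V) ∧
    ∀ (B : Type w) [NonUnitalCStarAlgebra B] (t : KPath V → B) (ht : KGraph.IsCKFamily k t),
      (∀ a : V, t (KPath.vertex a) ≠ 0) →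
        Set.InjOn (KGraph.CStar.lift ht) (KGraph.CStar.core k V) := by
  refine ⟨KGraph.CStar.isAF_core, fun B _ t ht hne a ha b hb hab => ?_⟩
  have := KGraph.CStar.norm_map_of_mem_core (KGraph.CStar.lift ht)
    (fun c => by rw [KGraph.CStar.lift_gen]; exact hne c) (sub_mem ha hb)
  rw [map_sub, hab, sub_self, norm_zero] at this
  exact sub_eq_zero.1 (norm_eq_zero.1 this.symm)
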